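/- There are a randomized algorithm and an absolute constant $C$ such that the following holds. Let $(X,\mathcal R)$ be a finite set system (a finite set $X$ and a family $\mathcal R$ of distinct subsets of $X$) with $|X|\ge 3$, and let $k<|\mathcal R|$ be such that there is a set cover of size $k$, i.e. $k$ sets of $\mathcal R$ whose union is $X$. The algorithm receives $|X|$, $|\mathcal R|$ and $k$, addresses the elements of $X$ and the sets of $\mathcal R$ by indices in arbitrary enumerations, and otherwise accesses the system only through a membership oracle: a data structure which is built in time $T_P$, occupies $S_O$ memory cells, and, once built, answers each query "$z\in r$?" ($z\in X$, $r\in\mathcal R$) in time $T_Q\ge 1$. Let $\log$ be the binary logarithm and $\delta=\log|X|$. Then the algorithm halts with probability $1$; whenever it halts, its output is a set cover of $(X,\mathcal R)$ of size at most $C\,\delta k\log(\delta k)$; its expected running time is at most \[ C\left(k\log\left(\frac{|\mathcal R|}{k}\right)T_Q\Bigl(|X|\,k\,\log(|X|k)\,\log(\log|X|)+|\mathcal R|\Bigr)+T_P\right); \] and in every run it uses at most $C(|\mathcal R|+S_O)$ memory cells, including those of the oracle's data structure. Here the model of computation is a random access machine with addition, subtraction, comparison with zero, indirect addressing and the drawing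 of a uniformly random integer from $\{0,\dots,a-1\}$ for a number $a$ in memory, each at unit cost (a call of the oracle costs one unit plus the time of the oracle), and every number in the algorithm's memory is at most $(|X|+|\mathcal R|)^{C}$. -/

import Mathlib

/-- `S` is a set cover of the set system `R` on the ground set `X`: a subfamily of `R` whose union
is all of `X`. -/
def IsSetCover {X : Type*} (R S : Finset (Finset X)) : Prop :=
  S ⊆ R ∧ ∀ x : X, ∃ r ∈ S, x ∈ r

namespace RAM

/-- Programs of a randomized random access machine with a membership oracle. The registers are
numbered by `ℕ` and hold natural numbers. The arithmetic is that of the Cook–Reckhow machine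
(addition and truncated subtraction), with indirect addressing and structured control flow. -/
inductive Program : Type
  /-- do nothing -/
  | skip : Program
  /-- `reg[d] := n` -/
  | const (d n : ℕ) : Program
  /-- `reg[d] := reg[a] + reg[b]` -/
  | add (d a b : ℕ) : Program
  /-- `reg[d] := reg[a] - reg[b]`, truncated at zero -/
  | sub (d a b : ℕ) : Program
  /-- `reg[d] := reg[reg[a]]` -/
  | load (d a : ℕ) : Program
  /-- `reg[reg[a]] := reg[b]` -/
  | store (a b : ℕ) : Program
  /-- `reg[d] :=` a fresh uniformly random element of `{0, …, reg[a] - 1}` (and `0` if `reg[a]` is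
  zero) -/
  | rand (d a : ℕ) : Program
  /-- run the preprocessing of the oracle, which builds its data structure -/
  | build : Program
  /-- `reg[d] := 1` if the data structure answers that the element with index `reg[a]` belongs to
  the set with index `reg[b]`, and `reg[d] := 0` otherwise -/
  | query (d a b : ℕ) : Program
  /-- first `p`, then `q` -/
  | seq (p q : Program) : Program
  /-- if `reg[a] > 0` then `p` else `q` -/
  | ifPos (a : ℕ) (p q : Program) : Program
  /-- while `reg[a] > 0` do `p` -/
  | whilePos (a : ℕ) (p : Program) : Program

/-- A membership oracle as the machine sees it: the answer for an element index and a set index,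
the time to build the data structure, the time to answer one query, and the number of memory cells
that the data structure occupies. -/
structure Oracle where
  answer : ℕ → ℕ → Bool
  buildTime : ℕ
  queryTime : ℕ
  space : ℕ

open Classical in
/-- The membership oracle of a set system `R` on `X`, whose elements and sets are addressed through
the enumerations `eX` and `eR`, with preprocessing time `TP`, query time `TQ` and space `SO`. -/
noncomputable def membershipOracle {X : Type*} {R : Finset (Finset X)} {n m : ℕ}
    (eX : Fin n ≃ X) (eR : Fin m ≃ R) (TP TQ SO : ℕ) : Oracle where
  answer i j := if h : i < n ∧ j < m then decide (eX ⟨i, h.1⟩ ∈ (eR ⟨j, h.2⟩ : Finset X)) else false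
  buildTime := TP
  queryTime := TQ
  space := SO

/-- A configuration: what is left to execute, the contents of the registers, and whether the data
structure of the oracle has been built. -/
structure Config where
  todo : List Program
  reg : ℕ → ℕ
  built : Bool

/-- The machine has halted when nothing is left to execute. -/
def Config.Halted (c : Config) : Prop := c.todo = []

/-- The initial configuration of program `P` on the input numbers `n, m, k`, given in the registers
`0, 1, 2`; all other registers are zero and nothing is built. -/
def init (P : Program) (n m k : ℕ) : Config where
  todo := [P]
  reg i := if i = 0 then n else if i = 1 then m else if i = 2 then k else 0
  built := false

/-- One step of the machine: the distribution of the next configuration. A halted configuration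
stays where it is. A query without a data structure yields `0`. -/
noncomputable def step (O : Oracle) : Config → PMF Config
  | ⟨[], ρ, b⟩ => PMF.pure ⟨[], ρ, b⟩
  | ⟨.skip :: K, ρ, b⟩ => PMF.pure ⟨K, ρ, b⟩
  | ⟨.const d n :: K, ρ, b⟩ => PMF.pure ⟨K, Function.update ρ d n, b⟩
  | ⟨.add d x y :: K, ρ, b⟩ => PMF.pure ⟨K, Function.update ρ d (ρ x + ρ y), b⟩
  | ⟨.sub d x y :: K, ρ, b⟩ => PMF.pure ⟨K, Function.update ρ d (ρ x - ρ y), b⟩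
  | ⟨.load d x :: K, ρ, b⟩ => PMF.pure ⟨K, Function.update ρ d (ρ (ρ x)), b⟩
  | ⟨.store x y :: K, ρ, b⟩ => PMF.pure ⟨K, Function.update ρ (ρ x) (ρ y), b⟩
  | ⟨.rand d x :: K, ρ, b⟩ =>
      (PMF.uniformOfFinset (Finset.range (max (ρ x) 1))
        (Finset.nonempty_range_iff.mpr (by omega))).map
        fun v => ⟨K, Function.update ρ d v, b⟩
  | ⟨.build :: K, ρ, _⟩ => PMF.pure ⟨K, ρ, true⟩
  | ⟨.query d x y :: K, ρ, b⟩ =>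
      PMF.pure ⟨K, Function.update ρ d (if b && O.answer (ρ x) (ρ y) then 1 else 0), b⟩
  | ⟨.seq p q :: K, ρ, b⟩ => PMF.pure ⟨p :: q :: K, ρ, b⟩
  | ⟨.ifPos x p q :: K, ρ, b⟩ => PMF.pure ⟨(if 0 < ρ x then p else q) :: K, ρ, b⟩
  | ⟨.whilePos x p :: K, ρ, b⟩ =>
      PMF.pure ⟨if 0 < ρ x then p :: .whilePos x p :: K else K, ρ, b⟩

/-- The time taken by the next step: one unit, plus the time of the oracle if it is invoked. -/
def stepTime (O : Oracle) (c : Config) : ℕ :=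
  match c.todo with
  | [] => 0
  | .build :: _ => 1 + O.buildTime
  | .query _ _ _ :: _ => 1 + O.queryTime
  | _ :: _ => 1

/-- The distribution of the configuration after `t` steps from `c`. -/
noncomputable def run (O : Oracle) (c : Config) : ℕ → PMF Config
  | 0 => PMF.pure c
  | t + 1 => (run O c t).bind (step O)

/-- The configuration `c'` occurs with positive probability in the computation from `c`. -/
def Reachable (O : Oracle) (c c' : Config) : Prop :=
  ∃ t, c' ∈ (run O c t).support

/-- The probability that the computation from `c` halts. -/
noncomputable def haltProb (O : Oracle) (c : Config) : ENNReal :=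
  ⨆ t, (run O c t).toOuterMeasure {c' | c'.Halted}

/-- The expected running time of the computation from `c`: the sum over all `t` of the expected
time taken by step `t`. -/
noncomputable def expectedTime (O : Oracle) (c : Config) : ENNReal :=
  ∑' t, ∑' c', run O c t c' * (stepTime O c' : ENNReal)

/-- The configuration `c` fits into `s` memory cells: its nonzero registers lie within an initial
segment that, with the data structure of the oracle if it has been built, takes at most `s`
cells. -/
def FitsIn (O : Oracle) (c : Config) (s : ℕ) : Prop :=
  ∃ b, (∀ i, b ≤ i → c.reg i = 0) ∧ b + (if c.built then O.space else 0) ≤ s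

/-- The output of a halted configuration: the set of the `reg[1]` numbers that are stored in
consecutive registers from address `reg[0]` on. -/
def Config.output (c : Config) : Finset ℕ :=
  (Finset.range (c.reg 1)).image fun i => c.reg (c.reg 0 + i)

end RAM

/-!
The algorithm is a variant of the reweighting method of Clarkson and of Brönnimann and Goodrich.
Every set carries a weight, initially `1`; let `W` be the total weight. A round draws a random
sample that contains each set independently with probability `min (s * w / W) 1`, where `w` is the
weight of the set, `s = 2 k l`, and `l` is the least number with `4 n ≤ 2 ^ l`. Samples of more
than `4 s` sets are discarded. If the sample is a cover, it is the output. Otherwise some element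
`x` is not covered; if it is light, that is, if the sets containing it weigh at most `W / (2 k)`,
their weights are doubled.

Independent choices replace a sample of fixed size. They need a single pass over the sets, no
binary search, and no more than `m` cells for the sample. The comparison `r < s * w` with a random
number `r < W` needs no multiplication, since the scaled weights `s * w` are kept in a second
table.

The sample has expected size at most `s`, so it is too large with probability at most `1 / 4`. An
element that is not light is missed with probability at most `exp (-l) ≤ 1 / (4 n)`. So with
probability at least `1 / 2` the sample is good (`RAM.mix_bad_le`): the round ends with a cover or
with a reweighting. A reweighting increases `W` by a factor of at most `1 + 1 / (2 k)`, and it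
doubles the weight of a set in the hidden cover of size `k`. The AM-GM inequality therefore bounds
the number of reweightings by `4 k log (m / k)` and the weights by `m ^ 4`
(`RAM.Progress.le_maxSteps`, `RAM.Progress.total_le_pow`). Since `k log (m / k) ≥ 1`, this covers
the last round as well.

Halting, the correctness of the output, the space bounds and the running time are all derived from
one quantity, the expected charge `RAM.value`. A step is charged its running time, or infinity in a
configuration that violates the space bounds or has halted with a wrong output. A finite bound on
the expected charge bounds the expected time, excludes violations in all reachable configurations,
and forces the machine to halt almost surely. Bounds on the charge are composed along the structure
of the program by Hoare triples in continuation-passing form (`RAM.Env.Hoare`); the only random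
step, in the sampling loop, averages the bounds over its outcomes (`RAM.val_sampleLoop_le`).
-/

namespace RAM

open scoped ENNReal

/-! ### Expectations along a run -/

theorem tsum_pure_mul {α : Type*} (a : α) (g : α → ℝ≥0∞) :
    ∑' b, PMF.pure a b * g b = g a := by
  rw [tsum_eq_single a]
  · simp
  · intro b hb
    simp [hb]

theorem tsum_bind_mul {α β : Type*} (p : PMF α) (f : α → PMF β) (g : β → ℝ≥0∞) :
    ∑' b, p.bind f b * g b = ∑' a, p a * ∑' b, f a b * g b := by
  simp_rw [PMF.bind_apply, ← ENNReal.tsum_mul_right, ← ENNReal.tsum_mul_left]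
  rw [ENNReal.tsum_comm]
  simp_rw [mul_assoc]

theorem tsum_uniform_map_mul {β : Type*} (s : Finset ℕ) (hs : s.Nonempty) (f : ℕ → β)
    (g : β → ℝ≥0∞) :
    ∑' b, (PMF.uniformOfFinset s hs).map f b * g b = (s.card : ℝ≥0∞)⁻¹ * ∑ v ∈ s, g (f v) := by
  rw [PMF.map, tsum_bind_mul, tsum_eq_sum (s := s), Finset.mul_sum]
  · refine Finset.sum_congr rfl fun v hv => ?_
    rw [PMF.uniformOfFinset_apply_of_mem hs hv, Function.comp_apply, tsum_pure_mul]
  · intro v hv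
    rw [PMF.uniformOfFinset_apply_of_notMem hs hv, zero_mul]

theorem run_succ_eq_step_bind (O : Oracle) (c : Config) (t : ℕ) :
    run O c (t + 1) = (step O c).bind fun c' => run O c' t := by
  induction t with
  | zero => simp [run]
  | succ t ih =>
    have h : run O c (t + 1 + 1) = (run O c (t + 1)).bind (step O) := rfl
    rw [h, ih, PMF.bind_bind]
    rfl

open Classical in
/-- The time charged for the next step: its running time, or infinity if the configuration violates
the safety predicate `Ok`. Finite expected charge thus certifies that `Ok` holds in every
reachable configuration. -/
noncomputable def charge (O : Oracle) (Ok : Config → Prop) (c : Config) : ℝ≥0∞ :=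
  if Ok c then (stepTime O c : ℝ≥0∞) else ⊤

/-- The expected charge of the first `t` steps from a configuration, by recursion on the first
step. -/
noncomputable def value (O : Oracle) (Ok : Config → Prop) : ℕ → Config → ℝ≥0∞
  | 0, _ => 0
  | t + 1, c => charge O Ok c + ∑' c', step O c c' * value O Ok t c'

theorem sum_run_charge (O : Oracle) (Ok : Config → Prop) (t : ℕ) (c : Config) :
    ∑ s ∈ Finset.range t, ∑' c', run O c s c' * charge O Ok c' = value O Ok t c := by
  induction t generalizing c with
  | zero => simp [value]
  | succ t ih =>
    rw [Finset.sum_range_succ', add_comm, value]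
    congr 1
    · exact tsum_pure_mul c _
    · simp_rw [run_succ_eq_step_bind, tsum_bind_mul, ← ih, Finset.mul_sum]
      rw [Summable.tsum_finsetSum fun _ _ => ENNReal.summable]

theorem value_mono (O : Oracle) (Ok : Config → Prop) (c : Config) :
    Monotone fun t => value O Ok t c := by
  intro s t h
  simp only [← sum_run_charge]
  exact Finset.sum_le_sum_of_subset (Finset.range_mono h)

section Adequacy

variable {O : Oracle} {Ok : Config → Prop} {c : Config} {T : ℝ≥0∞}

theorem tsum_run_charge_le (h : ∀ t, value O Ok t c ≤ T) :
    ∑' t, ∑' c', run O c t c' * charge O Ok c' ≤ T := by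
  refine ENNReal.tsum_le_of_sum_range_le fun t => ?_
  rw [sum_run_charge]
  exact h t

theorem expectedTime_le_of_value_le (h : ∀ t, value O Ok t c ≤ T) : expectedTime O c ≤ T := by
  refine le_trans ?_ (tsum_run_charge_le h)
  refine ENNReal.tsum_le_tsum fun t => ENNReal.tsum_le_tsum fun c' => ?_
  gcongr
  unfold charge
  split_ifs <;> simp

theorem ok_of_reachable (h : ∀ t, value O Ok t c ≤ T) (hT : T ≠ ⊤) {c' : Config}
    (hc : Reachable O c c') : Ok c' := by
  obtain ⟨t, ht⟩ := hc
  by_contra hok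
  refine hT (top_le_iff.mp ?_)
  calc ⊤ = run O c t c' * charge O Ok c' := by
        rw [charge, if_neg hok, ENNReal.mul_top ((PMF.mem_support_iff _ _).mp ht)]
    _ ≤ ∑' c', run O c t c' * charge O Ok c' := ENNReal.le_tsum c'
    _ ≤ ∑' t, ∑' c', run O c t c' * charge O Ok c' :=
        ENNReal.le_tsum (f := fun t => ∑' c', run O c t c' * charge O Ok c') t
    _ ≤ T := tsum_run_charge_le h

/-- Every step before halting takes at least one unit of time. -/
theorem one_le_stepTime (O : Oracle) {c : Config} (h : ¬ c.Halted) : 1 ≤ stepTime O c := by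
  obtain ⟨K, ρ, b⟩ := c
  match K with
  | [] => exact absurd rfl h
  | p :: K => cases p <;> simp [stepTime]

/-- A computation of finite expected running time halts almost surely: the probability of not
having halted by time `t` is at most the expected time of step `t`, which tends to zero. -/
theorem haltProb_eq_one_of_value_le (h : ∀ t, value O Ok t c ≤ T) (hT : T ≠ ⊤) :
    haltProb O c = 1 := by
  set e : ℕ → ℝ≥0∞ := fun t => ∑' c', run O c t c' * (stepTime O c' : ℝ≥0∞) with he
  have hlim : Filter.Tendsto e Filter.atTop (nhds 0) :=
    ENNReal.tendsto_atTop_zero_of_tsum_ne_top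
      (ne_top_of_le_ne_top hT (expectedTime_le_of_value_le h))
  have hsum : ∀ t, 1 ≤ (run O c t).toOuterMeasure {c' | c'.Halted} + e t := by
    intro t
    rw [PMF.toOuterMeasure_apply, he, ← ENNReal.tsum_add, ← PMF.tsum_coe (run O c t)]
    refine ENNReal.tsum_le_tsum fun c' => ?_
    by_cases hc : c'.Halted
    · simp [Set.indicator, hc]
    · have h1 : (1 : ℝ≥0∞) ≤ stepTime O c' := by exact_mod_cast one_le_stepTime O hc
      calc run O c t c' = run O c t c' * 1 := (mul_one _).symm
        _ ≤ run O c t c' * stepTime O c' := by gcongr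
        _ ≤ _ := le_add_self
  apply le_antisymm
  · refine iSup_le fun t => ?_
    rw [PMF.toOuterMeasure_apply, ← PMF.tsum_coe (run O c t)]
    exact ENNReal.tsum_le_tsum fun c' => Set.indicator_le_self _ _ _
  · have hle : ∀ t, 1 ≤ haltProb O c + e t := fun t => (hsum t).trans (by
      gcongr
      exact le_iSup (fun t => (run O c t).toOuterMeasure {c' | c'.Halted}) t)
    have h2 : Filter.Tendsto (fun t => haltProb O c + e t) Filter.atTop
        (nhds (haltProb O c + 0)) := hlim.const_add _
    rw [add_zero] at h2
    exact ge_of_tendsto' h2 hle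

end Adequacy

/-! ### Hoare triples with time bounds -/

/-- What a correctness argument for a program is relative to: the oracle, the number `B` of
registers available, the largest number `M` that may be stored, and the property `Good` that the
registers must have upon halting. -/
structure Env where
  O : Oracle
  B : ℕ
  M : ℕ
  Good : (ℕ → ℕ) → Prop

namespace Env

variable (E : Env)

/-- The registers respect the space bound and the size bound. -/
def Within (ρ : ℕ → ℕ) : Prop := (∀ i, ρ i ≤ E.M) ∧ ∀ i, E.B ≤ i → ρ i = 0

/-- The safety predicate: the bounds are respected, and the result is good if the machine has
halted. -/
def Ok (c : Config) : Prop := E.Within c.reg ∧ (c.todo = [] → E.Good c.reg)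

/-- A common upper bound for the time of every single step except `build`. -/
def unit : ℕ := 1 + E.O.queryTime

/-- The expected charge of the first `t` steps, once the data structure of the oracle is built. -/
noncomputable def val (t : ℕ) (K : List Program) (ρ : ℕ → ℕ) : ℝ≥0∞ :=
  value E.O E.Ok t ⟨K, ρ, true⟩

theorem val_mono {s t : ℕ} (h : s ≤ t) (K : List Program) (ρ : ℕ → ℕ) :
    E.val s K ρ ≤ E.val t K ρ :=
  value_mono E.O E.Ok _ h

variable {E}

theorem Within.update {ρ : ℕ → ℕ} (h : E.Within ρ) {d v : ℕ} (hd : d < E.B) (hv : v ≤ E.M) :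
    E.Within (Function.update ρ d v) := by
  constructor
  · intro i
    rw [Function.update_apply]
    split_ifs
    · exact hv
    · exact h.1 i
  · intro i hi
    rw [Function.update_of_ne (by omega)]
    exact h.2 i hi

theorem charge_le {p : Program} {K : List Program} {ρ : ℕ → ℕ} {b : Bool} (h : E.Within ρ)
    (hp : p ≠ .build) : charge E.O E.Ok ⟨p :: K, ρ, b⟩ ≤ E.unit := by
  have hok : E.Ok ⟨p :: K, ρ, b⟩ := ⟨h, fun h' => by simp at h'⟩
  rw [charge, if_pos hok]
  cases p <;> simp_all [stepTime, unit]

theorem val_nil {ρ : ℕ → ℕ} (h : E.Within ρ) (hg : E.Good ρ) (t : ℕ) : E.val t [] ρ = 0 := by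
  unfold val
  induction t with
  | zero => rfl
  | succ t ih =>
    have hok : E.Ok ⟨[], ρ, true⟩ := ⟨h, fun _ => hg⟩
    rw [value, charge, if_pos hok]
    simp only [step, tsum_pure_mul, ih]
    simp [stepTime]

theorem val_succ_cons_le {p : Program} {K K' : List Program} {ρ ρ' : ℕ → ℕ} {t : ℕ}
    (h : E.Within ρ) (hp : p ≠ .build)
    (hs : step E.O ⟨p :: K, ρ, true⟩ = PMF.pure ⟨K', ρ', true⟩) :
    E.val (t + 1) (p :: K) ρ ≤ E.unit + E.val t K' ρ' := by
  rw [val, value, hs, tsum_pure_mul]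
  exact add_le_add (charge_le h hp) le_rfl

theorem val_cons_le {p : Program} {K K' : List Program} {ρ ρ' : ℕ → ℕ} {t : ℕ} (h : E.Within ρ)
    (hp : p ≠ .build) (hs : step E.O ⟨p :: K, ρ, true⟩ = PMF.pure ⟨K', ρ', true⟩) :
    E.val t (p :: K) ρ ≤ E.unit + E.val t K' ρ' :=
  (E.val_mono t.le_succ _ _).trans (val_succ_cons_le h hp hs)

/-- Drawing a random number averages over its outcomes. -/
theorem val_rand_le {d x : ℕ} {K : List Program} {ρ : ℕ → ℕ} {t : ℕ} (h : E.Within ρ)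
    (hx : 0 < ρ x) :
    E.val t (.rand d x :: K) ρ ≤ E.unit +
      (ρ x : ℝ≥0∞)⁻¹ * ∑ v ∈ Finset.range (ρ x), E.val t K (Function.update ρ d v) := by
  cases t with
  | zero => simp [val, value]
  | succ t =>
    rw [val, value]
    simp only [step]
    rw [tsum_uniform_map_mul, Finset.card_range, max_eq_left hx]
    refine add_le_add (charge_le h (by simp)) ?_
    gcongr
    exact E.val_mono t.le_succ _ _

/-- The Hoare triple `{pre} p {post}` with time bound `T` (in multiples of `E.unit`), in
continuation-passing form: a bound `c` on the expected charge of the rest of the computation in all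
states satisfying `post` becomes a bound `T * E.unit + c` before `p`. -/
def Hoare (E : Env) (pre : (ℕ → ℕ) → Prop) (p : Program) (T : ℕ) (post : (ℕ → ℕ) → Prop) : Prop :=
  ∀ (t : ℕ) (K : List Program) (c : ℝ≥0∞) (ρ : ℕ → ℕ), E.Within ρ → pre ρ →
    (∀ ρ', E.Within ρ' → post ρ' → E.val t K ρ' ≤ c) →
    E.val t (p :: K) ρ ≤ ((T * E.unit : ℕ) : ℝ≥0∞) + c

theorem Hoare.conseq {pre pre' post post' : (ℕ → ℕ) → Prop} {p : Program} {T T' : ℕ}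
    (h : E.Hoare pre p T post) (h1 : ∀ ρ, E.Within ρ → pre' ρ → pre ρ) (hT : T ≤ T')
    (h2 : ∀ ρ, E.Within ρ → post ρ → post' ρ) : E.Hoare pre' p T' post' := by
  intro t K c ρ hw hp hc
  refine (h t K c ρ hw (h1 ρ hw hp) fun ρ' hw' hp' => hc ρ' hw' (h2 ρ' hw' hp')).trans ?_
  gcongr

theorem val_step_le {p : Program} {K K' : List Program} {ρ ρ' : ℕ → ℕ} {t T : ℕ} {c : ℝ≥0∞}
    (h : E.Within ρ) (hp : p ≠ .build)
    (hs : step E.O ⟨p :: K, ρ, true⟩ = PMF.pure ⟨K', ρ', true⟩)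
    (hc : E.val t K' ρ' ≤ ((T * E.unit : ℕ) : ℝ≥0∞) + c) :
    E.val t (p :: K) ρ ≤ (((1 + T) * E.unit : ℕ) : ℝ≥0∞) + c := by
  refine (val_cons_le h hp hs).trans ((add_le_add_right hc _).trans (le_of_eq ?_))
  push_cast
  ring

theorem Hoare.seq {pre mid post : (ℕ → ℕ) → Prop} {p q : Program} {T U : ℕ}
    (hp : E.Hoare pre p T mid) (hq : E.Hoare mid q U post) :
    E.Hoare pre (.seq p q) (1 + (T + U)) post := by
  intro t K c ρ hw hpre hc
  refine val_step_le hw (by simp) rfl ?_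
  have h := hp t (q :: K) _ ρ hw hpre fun ρ' hw' hm => hq t K c ρ' hw' hm hc
  refine h.trans (le_of_eq ?_)
  push_cast
  ring

theorem Hoare.ifPos {pre post : (ℕ → ℕ) → Prop} {x : ℕ} {p q : Program} {T : ℕ}
    (hp : E.Hoare (fun ρ => pre ρ ∧ 0 < ρ x) p T post)
    (hq : E.Hoare (fun ρ => pre ρ ∧ ρ x = 0) q T post) :
    E.Hoare pre (.ifPos x p q) (1 + T) post := by
  intro t K c ρ hw hpre hc
  by_cases hx : 0 < ρ x
  · exact val_step_le hw (by simp) (by simp only [step, if_pos hx])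
      (hp t K c ρ hw ⟨hpre, hx⟩ hc)
  · exact val_step_le hw (by simp) (by simp only [step, if_neg hx])
      (hq t K c ρ hw ⟨hpre, by omega⟩ hc)

/-- A sufficient precondition for a postcondition, which includes that the bounds on addresses and
numbers are respected. It is trivial (`False`) for programs that contain a loop, a random choice
or a call of `build`. -/
def wp (E : Env) : Program → ((ℕ → ℕ) → Prop) → (ℕ → ℕ) → Prop
  | .skip, post => post
  | .const d n, post => fun ρ => d < E.B ∧ n ≤ E.M ∧ post (Function.update ρ d n)
  | .add d x y, post => fun ρ =>
      d < E.B ∧ ρ x + ρ y ≤ E.M ∧ post (Function.update ρ d (ρ x + ρ y))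
  | .sub d x y, post => fun ρ => d < E.B ∧ post (Function.update ρ d (ρ x - ρ y))
  | .load d x, post => fun ρ => d < E.B ∧ post (Function.update ρ d (ρ (ρ x)))
  | .store x y, post => fun ρ => ρ x < E.B ∧ post (Function.update ρ (ρ x) (ρ y))
  | .query d x y, post => fun ρ =>
      d < E.B ∧ 1 ≤ E.M ∧ post (Function.update ρ d (if E.O.answer (ρ x) (ρ y) then 1 else 0))
  | .seq p q, post => E.wp p (E.wp q post)
  | .ifPos x p q, post => fun ρ => (0 < ρ x → E.wp p post ρ) ∧ (ρ x = 0 → E.wp q post ρ)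
  | _, _ => fun _ => False

/-- An upper bound on the number of steps of a program without loops (junk for loops). -/
def steps : Program → ℕ
  | .seq p q => 1 + (steps p + steps q)
  | .ifPos _ p q => 1 + max (steps p) (steps q)
  | _ => 1

theorem hoare_wp (p : Program) (post : (ℕ → ℕ) → Prop) :
    E.Hoare (E.wp p post) p (steps p) post := by
  have basic : ∀ {p : Program} {K : List Program} {ρ ρ' : ℕ → ℕ} {t : ℕ} {c : ℝ≥0∞},
      E.Within ρ → p ≠ .build → step E.O ⟨p :: K, ρ, true⟩ = PMF.pure ⟨K, ρ', true⟩ →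
      E.val t K ρ' ≤ c → E.val t (p :: K) ρ ≤ ((1 * E.unit : ℕ) : ℝ≥0∞) + c := by
    intro p K ρ ρ' t c h hp hs hc
    simpa using val_step_le (T := 0) h hp hs (by simpa using hc)
  induction p generalizing post with
  | skip =>
    intro t K c ρ hw hp hc
    exact basic hw (by simp) rfl (hc _ hw hp)
  | const d n =>
    intro t K c ρ hw hp hc
    exact basic hw (by simp) rfl (hc _ (hw.update hp.1 hp.2.1) hp.2.2)
  | add d x y =>
    intro t K c ρ hw hp hc
    exact basic hw (by simp) rfl (hc _ (hw.update hp.1 hp.2.1) hp.2.2)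
  | sub d x y =>
    intro t K c ρ hw hp hc
    exact basic hw (by simp) rfl
      (hc _ (hw.update hp.1 ((Nat.sub_le _ _).trans (hw.1 x))) hp.2)
  | load d x =>
    intro t K c ρ hw hp hc
    exact basic hw (by simp) rfl (hc _ (hw.update hp.1 (hw.1 _)) hp.2)
  | store x y =>
    intro t K c ρ hw hp hc
    exact basic hw (by simp) rfl (hc _ (hw.update hp.1 (hw.1 _)) hp.2)
  | rand d x => intro t K c ρ hw hp; exact hp.elim
  | build => intro t K c ρ hw hp; exact hp.elim
  | query d x y =>
    intro t K c ρ hw hp hc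
    refine basic hw (by simp) (by simp only [step, Bool.true_and])
      (hc _ (hw.update hp.1 ?_) hp.2.2)
    have := hp.2.1
    split_ifs <;> omega
  | seq p q ihp ihq => exact (ihp _).seq (ihq _)
  | ifPos x p q ihp ihq =>
    exact Hoare.ifPos ((ihp post).conseq (fun _ _ h => h.1.1 h.2) (le_max_left _ _) fun _ _ h => h)
      ((ihq post).conseq (fun _ _ h => h.1.2 h.2) (le_max_right _ _) fun _ _ h => h)
  | whilePos x p ih => intro t K c ρ hw hp; exact hp.elim

theorem hoare_of_wp {pre post : (ℕ → ℕ) → Prop} {p : Program} {T : ℕ}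
    (h : ∀ ρ, E.Within ρ → pre ρ → E.wp p post ρ) (hT : steps p ≤ T) : E.Hoare pre p T post :=
  (hoare_wp p post).conseq h hT fun _ _ h => h

theorem val_while_zero {x : ℕ} {p : Program} {K : List Program} {ρ : ℕ → ℕ} {t : ℕ}
    (hw : E.Within ρ) (hx : ρ x = 0) :
    E.val t (.whilePos x p :: K) ρ ≤ E.unit + E.val t K ρ :=
  val_cons_le hw (by simp) (by simp only [step, hx, lt_irrefl, if_false])

theorem val_while_pos {x : ℕ} {p : Program} {K : List Program} {ρ : ℕ → ℕ} {t : ℕ}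
    (hw : E.Within ρ) (hx : 0 < ρ x) :
    E.val t (.whilePos x p :: K) ρ ≤ E.unit + E.val t (p :: .whilePos x p :: K) ρ :=
  val_cons_le hw (by simp) (by simp only [step, hx, if_true])

/-- The rule for loops whose variant `r` is the number of iterations that remain. -/
theorem hoare_while {x : ℕ} {p : Program} {T : ℕ} (I : ℕ → (ℕ → ℕ) → Prop)
    (h0 : ∀ ρ, I 0 ρ → ρ x = 0) (h1 : ∀ r ρ, I (r + 1) ρ → 0 < ρ x)
    (hp : ∀ r, E.Hoare (I (r + 1)) p T (I r)) (r : ℕ) :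
    E.Hoare (I r) (.whilePos x p) (r * (T + 1) + 1) (I 0) := by
  induction r with
  | zero =>
    intro t K c ρ hw hI hc
    refine (val_while_zero hw (h0 ρ hI)).trans ?_
    simpa using hc ρ hw hI
  | succ r ih =>
    intro t K c ρ hw hI hc
    refine (val_while_pos hw (h1 r ρ hI)).trans ?_
    have h := hp r t (.whilePos x p :: K) _ ρ hw hI fun ρ' hw' hI' => ih t K c ρ' hw' hI' hc
    refine (add_le_add_right h _).trans (le_of_eq ?_)
    push_cast
    ring

end Env

/-! ### The algorithm -/

/-- Sequential composition of a list of programs. -/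
def block : List Program → Program
  | [] => .skip
  | [p] => p
  | p :: q :: l => .seq p (block (q :: l))

/-- `reg[d] := reg[a] * reg[b]`, with `reg[c]` as a counter. Register `3` holds `1`, here and in
all other programs. -/
def mulProg (d a b c : ℕ) : Program :=
  .seq (block [.const d 0, .const c 0, .add c c b])
    (.whilePos c (block [.add d d a, .sub c c 3]))

/-- Compare the element `reg[18]` with one set of the sample; clear the flag `reg[23]` if the set
contains it. -/
def innerBody : Program :=
  block [.sub 22 22 3, .add 14 6 22, .load 15 14, .query 15 18 15, .ifPos 15 (.const 23 0) .skip]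

/-- Check whether the sample covers the element `reg[20] - 1`, and record it in `reg[21]` if not. -/
def outerBody : Program :=
  .seq (block [.sub 18 20 3, .const 23 1, .const 22 0, .add 22 22 16])
    (.seq (.whilePos 22 innerBody)
      (block [.ifPos 23 (block [.const 21 0, .add 21 21 20]) .skip, .sub 20 20 3]))

/-- Set `reg[21]` to `x + 1` for an element `x` that the sample does not cover, or to `0` if there
is none. -/
def coverCheck : Program :=
  .seq (block [.const 20 0, .add 20 20 0, .const 21 0]) (.whilePos 20 outerBody)

/-- Compute in `reg[24]` the weight of the sets that contain the element `reg[18]`. -/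
def weigh : Program :=
  .seq (block [.const 24 0, .const 13 0, .add 13 13 1])
    (.whilePos 13 (block [.sub 13 13 3, .query 15 18 13,
      .ifPos 15 (block [.add 14 4 13, .load 15 14, .add 24 24 15]) .skip]))

/-- Double the weights of the sets that contain the element `reg[18]`; their weight is in
`reg[24]`. -/
def doubleWeights : Program :=
  .seq (block [.add 10 10 24, .const 13 0, .add 13 13 1])
    (.whilePos 13 (block [.sub 13 13 3, .query 15 18 13,
      .ifPos 15 (block [.add 14 4 13, .load 15 14, .add 15 15 15, .store 14 15,
        .add 14 5 13, .load 15 14, .add 15 15 15, .store 14 15]) .skip]))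

/-- Double the weights at the uncovered element `reg[21] - 1` if it is light. -/
def reweight : Program :=
  .seq (.sub 18 21 3) (.seq weigh (.seq (mulProg 25 24 11 26)
    (.seq (.sub 25 25 10) (.ifPos 25 .skip doubleWeights))))

/-- Process a sample: discard it if it is too large; otherwise stop if it is a cover, and reweight
if it is not. -/
def processSample : Program :=
  .seq (.sub 17 16 9) (.ifPos 17 .skip (.seq coverCheck (.ifPos 21 reweight (.const 12 0))))

/-- Put the set `reg[13] - 1` into the sample with probability `min (v / W) 1`, where `v` is its
scaled weight and `W` the total weight. -/
def sampleBody : Program :=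
  .seq (.sub 13 13 3) (.seq (.rand 17 10) (block [.add 14 5 13, .load 15 14, .sub 15 15 17,
    .ifPos 15 (block [.add 14 6 16, .store 14 13, .add 16 16 3]) .skip]))

/-- One round: draw a sample and process it. -/
def roundBody : Program :=
  .seq (block [.const 16 0, .const 13 0, .add 13 13 1])
    (.seq (.whilePos 13 sampleBody) processSample)

/-- Set up the constants and the weights. -/
def setup : Program :=
  .seq (block [.const 3 1, .add 13 0 0, .add 13 13 13, .const 14 1, .const 7 0, .sub 15 13 14])
    (.seq (.whilePos 15 (block [.add 14 14 14, .add 7 7 3, .sub 15 13 14]))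
      (.seq (.add 11 2 2)
        (.seq (mulProg 8 11 7 13)
          (.seq (block [.add 9 8 8, .add 9 9 9, .const 4 32, .add 5 4 1, .add 6 5 1,
              .const 10 0, .add 10 10 1, .const 12 1, .const 13 0, .add 13 13 1])
            (.whilePos 13 (block [.sub 13 13 3, .add 14 4 13, .store 14 3, .add 14 5 13,
              .store 14 8]))))))

/-- The algorithm. Its registers hold: `0, 1, 2` the input `n, m, k`; `3` the number `1`; `4, 5, 6`
the base addresses `32, 32 + m, 32 + 2 m` of the weights, of the weights scaled by the sampling
rate, and of the sample; `7` the logarithmic factor `l`, `8` the sampling rate `s = 2 k l`; `9` the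
largest admissible sample size `4 s`; `10` the total weight; `11` the number `2 k`; `12` a flag that
is cleared when a cover is found; `16` the size of the sample; the other registers below `32` are
temporary. -/
def setCoverProgram : Program :=
  .seq .build (.seq setup (.seq (.whilePos 12 roundBody)
    (block [.const 0 0, .add 0 0 6, .const 1 0, .add 1 1 16])))

/-- The data of an instance: `n` elements, `m` sets, cover size `k`, and the logarithmic factor `l`
of the sampling rate. -/
structure Params where
  n : ℕ
  m : ℕ
  k : ℕ
  l : ℕ

/-- The sampling rate. -/
def Params.s (P : Params) : ℕ := 2 * P.k * P.l

/-! ### Invariants of the memory -/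

/-- The permanent part of the memory during the main loop: the sets have the weights `w`, and the
register for the total weight holds `W`. -/
structure Head (P : Params) (w : ℕ → ℕ) (W : ℕ) (ρ : ℕ → ℕ) : Prop where
  r0 : ρ 0 = P.n
  r1 : ρ 1 = P.m
  r3 : ρ 3 = 1
  r4 : ρ 4 = 32
  r5 : ρ 5 = 32 + P.m
  r6 : ρ 6 = 32 + 2 * P.m
  r9 : ρ 9 = 4 * P.s
  r10 : ρ 10 = W
  r11 : ρ 11 = 2 * P.k
  r12 : ρ 12 = 1
  hw : ∀ j < P.m, ρ (32 + j) = w j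
  hv : ∀ j < P.m, ρ (32 + P.m + j) = P.s * w j

theorem Head.update_temp {P : Params} {w : ℕ → ℕ} {W : ℕ} {ρ : ℕ → ℕ} (h : Head P w W ρ) {d : ℕ}
    (h1 : 13 ≤ d) (h2 : d < 32) (v : ℕ) : Head P w W (Function.update ρ d v) := by
  constructor
  all_goals first
    | intro j hj
      rw [Function.update_of_ne (by omega)]
      first | exact h.hw j hj | exact h.hv j hj
    | rw [Function.update_of_ne (by omega)]
      cases h
      assumption

@[simp]
theorem head_update_iff {P : Params} {w : ℕ → ℕ} {W : ℕ} {ρ : ℕ → ℕ} {d : ℕ} (h1 : 13 ≤ d)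
    (h2 : d < 32) (v : ℕ) : Head P w W (Function.update ρ d v) ↔ Head P w W ρ :=
  ⟨fun h => by simpa using h.update_temp h1 h2 (ρ d), fun h => h.update_temp h1 h2 v⟩

/-- The sample stored in the memory is the set `A`. -/
structure Sample (P : Params) (A : Finset ℕ) (ρ : ℕ → ℕ) : Prop where
  card : ρ 16 = A.card
  sub : A ⊆ Finset.range P.m
  image : A = (Finset.range (ρ 16)).image fun i => ρ (32 + 2 * P.m + i)

theorem Sample.le {P : Params} {A : Finset ℕ} {ρ : ℕ → ℕ} (h : Sample P A ρ) : A.card ≤ P.m := by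
  simpa using Finset.card_le_card h.sub

theorem Sample.update_temp {P : Params} {A : Finset ℕ} {ρ : ℕ → ℕ} (h : Sample P A ρ) {d : ℕ}
    (h1 : d ≠ 16) (h2 : d < 32) (v : ℕ) : Sample P A (Function.update ρ d v) := by
  have h16 : Function.update ρ d v 16 = ρ 16 := Function.update_of_ne (by omega) _ _
  refine ⟨h16.trans h.card, h.sub, ?_⟩
  rw [h16]
  refine h.image.trans (Finset.image_congr fun i _ => ?_)
  exact (Function.update_of_ne (by omega) _ _).symm

@[simp]
theorem sample_update_iff {P : Params} {A : Finset ℕ} {ρ : ℕ → ℕ} {d : ℕ} (h1 : d ≠ 16)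
    (h2 : d < 32) (v : ℕ) : Sample P A (Function.update ρ d v) ↔ Sample P A ρ :=
  ⟨fun h => by simpa using h.update_temp h1 h2 (ρ d), fun h => h.update_temp h1 h2 v⟩

@[simp]
theorem update_high (ρ : ℕ → ℕ) {d : ℕ} (hd : d < 32) (v i : ℕ) :
    Function.update ρ d v (32 + i) = ρ (32 + i) :=
  Function.update_of_ne (by omega) _ _

@[simp]
theorem update_high' (ρ : ℕ → ℕ) {d : ℕ} (hd : d < 32) (v i j : ℕ) :
    Function.update ρ d v (32 + i + j) = ρ (32 + i + j) :=
  Function.update_of_ne (by omega) _ _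

@[simp]
theorem update_low (ρ : ℕ → ℕ) {d : ℕ} (hd : d < 32) (v i : ℕ) :
    Function.update ρ (32 + i) v d = ρ d :=
  Function.update_of_ne (by omega) _ _

@[simp]
theorem update_low' (ρ : ℕ → ℕ) {d : ℕ} (hd : d < 32) (v i j : ℕ) :
    Function.update ρ (32 + i + j) v d = ρ d :=
  Function.update_of_ne (by omega) _ _

/-- The numbers that do not depend on the weights respect the bounds of the machine. -/
structure Roomy (E : Env) (P : Params) : Prop where
  hB : E.B = 32 + 3 * P.m
  hn : 8 * P.n ≤ E.M
  hm : 32 + 3 * P.m ≤ E.M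
  hs : 4 * P.s ≤ E.M
  hk : 1 ≤ P.k
  hl : 1 ≤ P.l

theorem Roomy.two_mul_le {E : Env} {P : Params} (hE : Roomy E P) : 2 * P.k ≤ P.s :=
  Nat.le_mul_of_pos_right _ hE.hl

section Deterministic

variable {E : Env} {P : Params} {w : ℕ → ℕ} {A : Finset ℕ}

/-- Multiplication preserves every property `F` that does not depend on the target and the
counter. -/
theorem hoare_mul {d a b c u v : ℕ} {F : (ℕ → ℕ) → Prop} (hdB : d < E.B) (hcB : c < E.B)
    (hd : ∀ ρ v, F ρ → F (Function.update ρ d v)) (hc : ∀ ρ v, F ρ → F (Function.update ρ c v))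
    (hF : ∀ ρ, F ρ → ρ a = u ∧ ρ b = v ∧ ρ 3 = 1) (hdc : d ≠ c) (hM : u * v ≤ E.M)
    (hv : v ≤ E.M) :
    E.Hoare F (mulProg d a b c) (5 * v + 10) (fun ρ => F ρ ∧ ρ d = u * v) := by
  have hac : ∀ ρ, F ρ → ∀ z y, (Function.update (Function.update ρ d z) c y) b = v :=
    fun ρ h z y => (hF _ (hc _ y (hd _ z h))).2.1
  refine Env.Hoare.conseq (Env.Hoare.seq
    (mid := fun ρ => F ρ ∧ ρ c = v ∧ v ≤ v ∧ ρ d + v * u = u * v)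
    (Env.hoare_of_wp ?_ le_rfl)
    (Env.hoare_while (T := 3) (fun r ρ => F ρ ∧ ρ c = r ∧ r ≤ v ∧ ρ d + r * u = u * v)
      (fun ρ h => h.2.1) (fun r ρ h => by have := h.2.1; omega) (fun r => ?_) v))
    (fun _ _ h => h) (T' := 5 * v + 10) ?_ (fun ρ _ h => ⟨h.1, by simpa using h.2.2.2⟩)
  · intro ρ _ h
    have hb := hac ρ h 0 0
    simp [block, Env.wp, hdB, hcB, hb, hdc, hv, mul_comm, hc, hd, h]
  · refine Env.hoare_of_wp ?_ (by simp [block, Env.steps])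
    rintro ρ _ ⟨h, h1, h2, h3⟩
    have hF1 := hF ρ h
    have h31 := hF _ (hd ρ (ρ d + ρ a) h)
    have hle : ρ d + u ≤ E.M := by
      have : (r + 1) * u = r * u + u := by ring
      omega
    simp [block, Env.wp, hdB, hcB, hF1.1, hle, hdc.symm, hdc, h1] at h31 ⊢
    simp [h31]
    refine ⟨hc _ _ (hd _ _ h), by omega, ?_⟩
    rw [← h3]; ring
  · simp [block, Env.steps]; omega

/-- The inner loop of the cover check for the element `x`, with `r` sets of the sample left and an
arbitrary property `F` of the recorded element. -/
def InnerInv (E : Env) (P : Params) (w : ℕ → ℕ) (W : ℕ) (A : Finset ℕ) (x : ℕ) (F : ℕ → Prop)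
    (r : ℕ) (ρ : ℕ → ℕ) : Prop :=
  Head P w W ρ ∧ Sample P A ρ ∧ ρ 18 = x ∧ ρ 20 = x + 1 ∧ F (ρ 21) ∧ ρ 22 = r ∧ r ≤ A.card ∧
    ((ρ 23 = 0 ∧ ∃ j ∈ A, E.O.answer x j) ∨ (ρ 23 = 1 ∧ ∀ i, r ≤ i → i < A.card →
      E.O.answer x (ρ (32 + 2 * P.m + i)) = false))

theorem hoare_innerBody (hE : Roomy E P) {W : ℕ} (x : ℕ) (F : ℕ → Prop) (r : ℕ) :
    E.Hoare (InnerInv E P w W A x F (r + 1)) innerBody 10 (InnerInv E P w W A x F r) := by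
  refine Env.hoare_of_wp ?_ (by simp [innerBody, block, Env.steps])
  rintro ρ hw ⟨hH, hS, h18, h20, h21, h22, hr, h⟩
  have hB := hE.hB
  have hm := hE.hm
  have hle := hS.le
  have hM : 32 + 2 * P.m + r ≤ E.M := by omega
  have hM' : 1 ≤ E.M := by omega
  have hlt : 23 < 32 + 3 * P.m := by omega
  by_cases hq : E.O.answer x (ρ (32 + 2 * P.m + r)) = true
  · have hmem : ∃ j ∈ A, E.O.answer x j := by
      refine ⟨_, ?_, hq⟩
      rw [hS.image, Finset.mem_image]
      exact ⟨r, by rw [Finset.mem_range, hS.card]; omega, rfl⟩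
    simp [innerBody, block, Env.wp, hH.r3, hH.r6, h18, h20, h21, h22, hB, hq, hM, hM',
      InnerInv, hH, hS, hmem]
    omega
  · have hq' : E.O.answer x (ρ (32 + 2 * P.m + r)) = false := by simpa using hq
    simp [innerBody, block, Env.wp, hH.r3, hH.r6, h18, h20, h21, h22, hB, hq', hM, hM',
      InnerInv, hH, hS]
    refine ⟨by omega, by omega, by omega, by omega, h.imp_right fun h => ⟨h.1, fun i hi hi' => ?_⟩⟩
    rcases hi.eq_or_lt with rfl | hi
    · exact hq'
    · exact h.2 i hi hi'

/-- What is known about the recorded element `y` when the elements from `r` on have been checked: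
they are covered by the sample `A` if `y = 0`, and otherwise `y - 1` is not covered. -/
def CheckedFrom (E : Env) (P : Params) (A : Finset ℕ) (r y : ℕ) : Prop :=
  (y = 0 ∧ ∀ x, r ≤ x → x < P.n → ∃ j ∈ A, E.O.answer x j) ∨
    ∃ x < P.n, y = x + 1 ∧ ∀ j ∈ A, E.O.answer x j = false

/-- The outer loop of the cover check, with the elements below `r` left. -/
def OuterInv (E : Env) (P : Params) (w : ℕ → ℕ) (W : ℕ) (A : Finset ℕ) (r : ℕ) (ρ : ℕ → ℕ) :
    Prop :=
  Head P w W ρ ∧ Sample P A ρ ∧ ρ 20 = r ∧ r ≤ P.n ∧ CheckedFrom E P A r (ρ 21)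

theorem hoare_outerBody (hE : Roomy E P) {W : ℕ} (r : ℕ) :
    E.Hoare (OuterInv E P w W A (r + 1)) outerBody (11 * A.card + 30) (OuterInv E P w W A r) := by
  have hB := hE.hB
  have hm := hE.hm
  have hn := hE.hn
  by_cases hrn : r + 1 ≤ P.n
  swap
  · exact fun t K c ρ _ h => absurd h.2.2.2.1 hrn
  refine Env.Hoare.conseq (Env.Hoare.seq
    (mid := InnerInv E P w W A r (CheckedFrom E P A (r + 1)) A.card)
    (Env.hoare_of_wp ?_ le_rfl) (Env.Hoare.seq
    (Env.hoare_while (T := 10) (InnerInv E P w W A r (CheckedFrom E P A (r + 1)))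
      (fun ρ h => h.2.2.2.2.2.1) (fun r ρ h => by have := h.2.2.2.2.2.1; omega)
      (fun r' => hoare_innerBody hE r _ r') A.card)
    (Env.hoare_of_wp ?_ le_rfl)))
    (fun _ _ h => h) (T' := 11 * A.card + 30) ?_ (fun ρ _ h => h)
  · rintro ρ _ ⟨hH, hS, h20, _, h21⟩
    have hle := hS.le
    have h1 : 32 ≤ E.M := by omega
    have h2 : 1 ≤ E.M := by omega
    have h3 : A.card ≤ E.M := by omega
    simp [block, Env.wp, hB, hH.r3, h20, h2, h3, hS.card, InnerInv, hH, hS, h21]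
    refine ⟨by omega, by omega, by omega, fun i hi hi' => by omega⟩
  · rintro ρ _ ⟨hH, hS, h18, h20, h21, h22, _, h⟩
    have hM : r + 1 ≤ E.M := by omega
    have hr : r < P.n := by omega
    rcases h with ⟨h23, hj⟩ | ⟨h23, hj⟩
    · simp [block, Env.wp, hB, hH.r3, h20, h23, OuterInv, hH, hS]
      refine ⟨by omega, by omega, h21.imp_left fun h => ⟨h.1, fun x hx hx' => ?_⟩⟩
      rcases hx.eq_or_lt with rfl | hx
      · exact hj
      · exact h.2 x hx hx'
    · simp [block, Env.wp, hB, hH.r3, h20, h23, OuterInv, hH, hS, hM]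
      refine ⟨by omega, by omega, by omega, Or.inr ⟨r, hr, rfl, fun j hjA => ?_⟩⟩
      rw [hS.image, Finset.mem_image] at hjA
      obtain ⟨i, hi, rfl⟩ := hjA
      exact hj i (Nat.zero_le _) (by rwa [Finset.mem_range, hS.card] at hi)
  · simp [block, Env.steps]; omega

theorem hoare_coverCheck (hE : Roomy E P) {W : ℕ} {a : ℕ} (ha : A.card ≤ a) :
    E.Hoare (fun ρ => Head P w W ρ ∧ Sample P A ρ) coverCheck (P.n * (11 * a + 31) + 10)
      (fun ρ => Head P w W ρ ∧ Sample P A ρ ∧ CheckedFrom E P A 0 (ρ 21)) := by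
  have hB := hE.hB
  have hn := hE.hn
  refine Env.Hoare.conseq (Env.Hoare.seq (mid := OuterInv E P w W A P.n)
    (Env.hoare_of_wp ?_ le_rfl)
    (Env.hoare_while (OuterInv E P w W A) (fun ρ h => h.2.2.1)
      (fun r ρ h => by have := h.2.2.1; omega) (hoare_outerBody hE) P.n))
    (fun _ _ h => h) (T' := P.n * (11 * a + 31) + 10) ?_
    (fun ρ _ h => ⟨h.1, h.2.1, h.2.2.2.2⟩)
  · rintro ρ _ ⟨hH, hS⟩
    have hM : P.n ≤ E.M := by omega
    simp [block, Env.wp, hB, hH.r0, hM, OuterInv, hH, hS, CheckedFrom]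
    exact ⟨by omega, by omega, fun x hx hx' => by omega⟩
  · have : P.n * (11 * A.card + 30 + 1) ≤ P.n * (11 * a + 31) :=
      Nat.mul_le_mul_left _ (by omega)
    simp only [block, Env.steps]
    omega

/-- The total weight. -/
def total (P : Params) (w : ℕ → ℕ) : ℕ := ∑ j ∈ Finset.range P.m, w j

/-- The weight of the sets from `r` on that contain the element `x`. -/
def weightFrom (E : Env) (P : Params) (w : ℕ → ℕ) (x r : ℕ) : ℕ :=
  ∑ j ∈ Finset.Ico r P.m, if E.O.answer x j then w j else 0

theorem weightFrom_le_total (x r : ℕ) : weightFrom E P w x r ≤ total P w := by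
  unfold weightFrom total
  calc _ ≤ ∑ j ∈ Finset.Ico r P.m, w j := Finset.sum_le_sum fun j _ => by split_ifs <;> simp
    _ ≤ _ := Finset.sum_le_sum_of_subset fun j => by simp

theorem weight_le_total {j : ℕ} (hj : j < P.m) : w j ≤ total P w :=
  Finset.single_le_sum (f := w) (fun _ _ => Nat.zero_le _) (Finset.mem_range.mpr hj)

theorem weightFrom_eq {x r : ℕ} (hr : r < P.m) :
    weightFrom E P w x r = (if E.O.answer x r then w r else 0) + weightFrom E P w x (r + 1) :=
  Finset.sum_eq_sum_Ico_succ_bot hr _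

/-- The loop that weighs the sets containing `x`, with the sets below `r` left. -/
def WeighInv (E : Env) (P : Params) (w : ℕ → ℕ) (x r : ℕ) (ρ : ℕ → ℕ) : Prop :=
  Head P w (total P w) ρ ∧ ρ 18 = x ∧ ρ 13 = r ∧ r ≤ P.m ∧ ρ 24 = weightFrom E P w x r

theorem hoare_weigh (hE : Roomy E P) (hM : total P w ≤ E.M) (x : ℕ) :
    E.Hoare (fun ρ => Head P w (total P w) ρ ∧ ρ 18 = x) weigh (20 * P.m + 10)
      (fun ρ => Head P w (total P w) ρ ∧ ρ 18 = x ∧ ρ 24 = weightFrom E P w x 0) := by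
  have hB := hE.hB
  have hm := hE.hm
  refine Env.Hoare.conseq (Env.Hoare.seq (mid := WeighInv E P w x P.m)
    (Env.hoare_of_wp ?_ le_rfl)
    (Env.hoare_while (T := 15) (WeighInv E P w x) (fun ρ h => h.2.2.1)
      (fun r ρ h => by have := h.2.2.1; omega) (fun r => ?_) P.m))
    (fun _ _ h => h) (T' := 20 * P.m + 10) ?_ (fun ρ _ h => ⟨h.1, h.2.1, h.2.2.2.2⟩)
  · rintro ρ _ ⟨hH, h18⟩
    have h1 : P.m ≤ E.M := by omega
    simp [block, Env.wp, hB, hH.r1, h1, WeighInv, hH, h18, weightFrom]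
    omega
  · refine Env.hoare_of_wp ?_ (by simp [block, Env.steps])
    rintro ρ _ ⟨hH, h18, h13, hr, h24⟩
    have h1 : 1 ≤ E.M := by omega
    have h2 : 32 + r ≤ E.M := by omega
    have heq := weightFrom_eq (E := E) (P := P) (w := w) (x := x) (r := r) (by omega)
    have hle := weightFrom_le_total (E := E) (P := P) (w := w) x r
    have hwr := hH.hw r (by omega)
    by_cases hq : E.O.answer x r = true
    · simp [hq] at heq
      simp [block, Env.wp, hB, hH.r3, hH.r4, h18, h13, hq, h1, h2, hwr, WeighInv, hH, h24]
      omega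
    · simp [hq] at heq
      simp [block, Env.wp, hB, hH.r3, h18, h13, hq, h1, WeighInv, hH, h24]
      omega
  · simp [block, Env.steps]; omega

/-- The weights after doubling at the element `x` the weights of the sets from `r` on. -/
def doubleFrom (E : Env) (x r : ℕ) (w : ℕ → ℕ) (j : ℕ) : ℕ :=
  if r ≤ j ∧ E.O.answer x j then 2 * w j else w j

theorem Head.congr {W : ℕ} {w' : ℕ → ℕ} {ρ : ℕ → ℕ} (h : Head P w W ρ)
    (hw : ∀ j < P.m, w j = w' j) : Head P w' W ρ :=
  { h with
    hw := fun j hj => (h.hw j hj).trans (hw j hj)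
    hv := fun j hj => (h.hv j hj).trans (by rw [hw j hj]) }

/-- Replacing the weight of the single set `r` in both tables. -/
theorem Head.update_weight {W : ℕ} {w' : ℕ → ℕ} {ρ ρ' : ℕ → ℕ} (h : Head P w W ρ) {r : ℕ}
    (hw : ∀ j, j ≠ r → w' j = w j)
    (hρ : ∀ i, i < 13 ∨ 32 ≤ i → i ≠ 32 + r → i ≠ 32 + P.m + r → ρ' i = ρ i)
    (h1 : ρ' (32 + r) = w' r) (h2 : ρ' (32 + P.m + r) = P.s * w' r) (hr : r < P.m) :
    Head P w' W ρ' := by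
  constructor
  case hw =>
    intro j hj
    by_cases h' : j = r
    · rw [h', h1]
    · rw [hρ _ (by omega) (by omega) (by omega), h.hw j hj, hw j h']
  case hv =>
    intro j hj
    by_cases h' : j = r
    · rw [h', h2]
    · rw [hρ _ (by omega) (by omega) (by omega), h.hv j hj, hw j h']
  all_goals
    rw [hρ _ (by omega) (by omega) (by omega)]
    cases h
    assumption

/-- The loop that doubles the weights of the sets containing `x`, with the sets below `r` left. The
register for the total weight already holds its final value `W`. -/
def DoubleInv (E : Env) (P : Params) (w : ℕ → ℕ) (W x r : ℕ) (ρ : ℕ → ℕ) : Prop :=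
  Head P (doubleFrom E x r w) W ρ ∧ ρ 18 = x ∧ ρ 13 = r ∧ r ≤ P.m

theorem hoare_doubleWeights (hE : Roomy E P) (hM : 2 * P.s * total P w ≤ E.M) (x : ℕ) :
    E.Hoare
      (fun ρ => Head P w (total P w) ρ ∧ ρ 18 = x ∧ ρ 24 = weightFrom E P w x 0) doubleWeights
      (40 * P.m + 10)
      (Head P (doubleFrom E x 0 w) (total P w + weightFrom E P w x 0)) := by
  have hB := hE.hB
  have hm := hE.hm
  have hs : 2 * 1 ≤ P.s := (Nat.mul_le_mul_left 2 hE.hk).trans hE.two_mul_le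
  have hD := weightFrom_le_total (E := E) (P := P) (w := w) x 0
  have h2W : 2 * total P w ≤ E.M := le_trans (Nat.mul_le_mul_right _ (by omega)) hM
  refine Env.Hoare.conseq (Env.Hoare.seq
    (mid := DoubleInv E P w (total P w + weightFrom E P w x 0) x P.m)
    (Env.hoare_of_wp ?_ le_rfl)
    (Env.hoare_while (T := 25) (DoubleInv E P w (total P w + weightFrom E P w x 0) x)
      (fun ρ h => h.2.2.1)
      (fun r ρ h => by have := h.2.2.1; omega) (fun r => ?_) P.m))
    (fun _ _ h => h) (T' := 40 * P.m + 10) ?_ (fun ρ _ h => h.1)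
  · rintro ρ _ ⟨hH, h18, h24⟩
    have h1 : P.m ≤ E.M := by omega
    have h10 : Head P (doubleFrom E x P.m w) (total P w + weightFrom E P w x 0)
        (Function.update ρ 10 (total P w + weightFrom E P w x 0)) := by
      refine Head.congr (w := w) ?_ fun j hj => by
        rw [doubleFrom, if_neg (by omega)]
      constructor
      case r10 => simp
      case hw => intro j hj; simpa using hH.hw j hj
      case hv => intro j hj; simpa using hH.hv j hj
      all_goals
        rw [Function.update_of_ne (by omega)]
        cases hH
        assumption
    simp [block, Env.wp, hB, hH.r1, hH.r10, h24, h1, DoubleInv, h10, h18]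
    omega
  · refine Env.hoare_of_wp ?_ (by simp [block, Env.steps])
    rintro ρ _ ⟨hH, h18, h13, hr⟩
    have h1 : 1 ≤ E.M := by omega
    have h2 : 32 + r ≤ E.M := by omega
    have h3 : 32 + P.m + r ≤ E.M := by omega
    have hwr := hH.hw r (by omega)
    have hvr := hH.hv r (by omega)
    have hwt := weight_le_total (P := P) (w := w) (j := r) (by omega)
    have hd1 : doubleFrom E x (r + 1) w r = w r := if_neg (by omega)
    rw [hd1] at hwr hvr
    have h4 : w r + w r ≤ E.M := by omega
    have h5 : P.s * w r + P.s * w r ≤ E.M := by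
      calc _ = 2 * P.s * w r := by ring
        _ ≤ 2 * P.s * total P w := Nat.mul_le_mul_left _ hwt
        _ ≤ _ := hM
    have hne : ∀ j, j ≠ r → doubleFrom E x r w j = doubleFrom E x (r + 1) w j := by
      intro j hj
      have : r ≤ j ↔ r + 1 ≤ j := by omega
      simp only [doubleFrom, this]
    by_cases hq : E.O.answer x r = true
    · have hd : doubleFrom E x r w r = 2 * w r := if_pos ⟨le_rfl, hq⟩
      have hrd : ∀ (ρ : ℕ → ℕ) v, Function.update ρ (32 + r) v (32 + P.m + r) =
          ρ (32 + P.m + r) := fun ρ v => Function.update_of_ne (by omega) _ _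
      simp [block, Env.wp, hB, hH.r3, hH.r4, hH.r5, h18, h13, hq, h1, h2, h3, hwr, hvr, hrd,
        DoubleInv, h4, h5]
      refine ⟨by omega, by omega, by omega, by omega, by omega, by omega, by omega, by omega, ?_,
        by omega⟩
      refine hH.update_weight hne (fun i hi h' h'' => ?_) ?_ ?_ (by omega)
      · repeat rw [Function.update_of_ne (by omega)]
      · rw [Function.update_of_ne (by omega)]
        simp
        omega
      · rw [Function.update_self, hd]
        ring
    · have hd : doubleFrom E x r w r = w r := if_neg (by simp [hq])
      have hH' := hH.congr (w' := doubleFrom E x r w) fun j hj => by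
        by_cases hjr : j = r
        · subst hjr; rw [hd, hd1]
        · rw [hne j hjr]
      simp [block, Env.wp, hB, hH.r3, h18, h13, hq, h1, DoubleInv, hH']
      omega
  · simp [block, Env.steps]; omega

end Deterministic

/-! ### A round -/

section Rounds

variable {E : Env} {P : Params} {w : ℕ → ℕ} {A : Finset ℕ}

theorem total_doubleFrom (x : ℕ) :
    total P (doubleFrom E x 0 w) = total P w + weightFrom E P w x 0 := by
  unfold total weightFrom doubleFrom
  rw [← Finset.range_eq_Ico, ← Finset.sum_add_distrib]
  refine Finset.sum_congr rfl fun j _ => ?_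
  simp only [Nat.zero_le, true_and]
  split_ifs <;> ring

/-- The element `x` is light: the sets containing it have at most the fraction `1 / (2 k)` of the
total weight. -/
def Light (E : Env) (P : Params) (w : ℕ → ℕ) (x : ℕ) : Prop :=
  2 * P.k * weightFrom E P w x 0 ≤ total P w

/-- The memory after a reweighting at a light element. -/
def Reweighted (E : Env) (P : Params) (w : ℕ → ℕ) (ρ : ℕ → ℕ) : Prop :=
  ∃ x < P.n, Light E P w x ∧ Head P (doubleFrom E x 0 w) (total P (doubleFrom E x 0 w)) ρ

theorem hoare_reweight (hE : Roomy E P) (hM : 2 * P.s * total P w ≤ E.M) {x : ℕ} (hx : x < P.n) :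
    E.Hoare (fun ρ => Head P w (total P w) ρ ∧ ρ 21 = x + 1) reweight (60 * P.m + 10 * P.k + 50)
      (fun ρ => (Head P w (total P w) ρ ∧ ¬ Light E P w x) ∨ Reweighted E P w ρ) := by
  have hB := hE.hB
  have h2k := hE.two_mul_le
  have hs := hE.hs
  have hk := hE.hk
  have hD := weightFrom_le_total (E := E) (P := P) (w := w) x 0
  have htot : total P w ≤ E.M :=
    (Nat.le_mul_of_pos_left _ (by omega)).trans hM
  have hmul : weightFrom E P w x 0 * (2 * P.k) ≤ E.M := by
    calc _ ≤ total P w * (2 * P.s) := Nat.mul_le_mul hD (by omega)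
      _ = 2 * P.s * total P w := mul_comm _ _
      _ ≤ _ := hM
  have h26 : 26 < E.B := by omega
  have hdouble : E.Hoare (fun ρ => ((Head P w (total P w) ρ ∧ ρ 18 = x ∧
      ρ 24 = weightFrom E P w x 0) ∧ (ρ 25 = 0 ↔ Light E P w x)) ∧ ρ 25 = 0) doubleWeights
      (40 * P.m + 10)
      (fun ρ => (Head P w (total P w) ρ ∧ ¬ Light E P w x) ∨ Reweighted E P w ρ) := by
    by_cases hL : Light E P w x
    · refine (hoare_doubleWeights hE hM x).conseq (fun ρ _ h => h.1.1) le_rfl fun ρ _ h => ?_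
      exact Or.inr ⟨x, hx, hL, by rwa [total_doubleFrom]⟩
    · exact fun t K c ρ _ h => absurd (h.1.2.mp h.2) hL
  refine Env.Hoare.conseq (Env.Hoare.seq
    (mid := fun ρ => Head P w (total P w) ρ ∧ ρ 18 = x) (Env.hoare_of_wp ?_ le_rfl)
    (Env.Hoare.seq (hoare_weigh hE htot x)
    (Env.Hoare.seq
      (hoare_mul (u := weightFrom E P w x 0) (v := 2 * P.k) (by omega) h26 ?_ ?_ ?_
        (by omega) hmul (by omega))
    (Env.Hoare.seq (mid := fun ρ => (Head P w (total P w) ρ ∧ ρ 18 = x ∧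
        ρ 24 = weightFrom E P w x 0) ∧ (ρ 25 = 0 ↔ Light E P w x)) (Env.hoare_of_wp ?_ le_rfl)
    (Env.Hoare.ifPos (T := 40 * P.m + 10) (Env.hoare_of_wp ?_ (by simp [Env.steps]))
      hdouble)))))
    (fun _ _ h => h) (T' := 60 * P.m + 10 * P.k + 50) ?_ (fun ρ _ h => h)
  · rintro ρ _ ⟨hH, h21⟩
    simp [Env.wp, hH.r3, hH, h21]
    omega
  · rintro ρ v ⟨hH, h18, h24⟩
    simp [hH, h18, h24]
  · rintro ρ v ⟨hH, h18, h24⟩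
    simp [hH, h18, h24]
  · rintro ρ ⟨hH, h18, h24⟩
    exact ⟨h24, hH.r11, hH.r3⟩
  · rintro ρ _ ⟨⟨hH, h18, h24⟩, h25⟩
    simp [Env.wp, hH.r10, hH, h18, h24, h25, Light, Nat.sub_eq_zero_iff_le, mul_comm]
    omega
  · rintro ρ _ ⟨⟨⟨hH, h18, h24⟩, h25⟩, hpos⟩
    exact Or.inl ⟨hH, fun h => by have := h25.mpr h; omega⟩
  · simp only [Env.steps]; omega

/-- The sample `A` is small and hits all elements that are not light. A good sample makes progress:
it is a cover, or an element that it does not cover is light. -/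
def GoodSample (E : Env) (P : Params) (w : ℕ → ℕ) (A : Finset ℕ) : Prop :=
  A.card ≤ 4 * P.s ∧ ∀ x < P.n, ¬ Light E P w x → ∃ j ∈ A, E.O.answer x j

/-- The index set `A` is a cover of admissible size. -/
def SmallCover (E : Env) (P : Params) (A : Finset ℕ) : Prop :=
  A.card ≤ 4 * P.s ∧ ∀ x < P.n, ∃ j ∈ A, E.O.answer x j

/-- The memory after a cover has been found. -/
def Found (E : Env) (P : Params) (ρ : ℕ → ℕ) : Prop :=
  ρ 12 = 0 ∧ ρ 6 = 32 + 2 * P.m ∧ ∃ A, Sample P A ρ ∧ SmallCover E P A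

theorem hoare_processSample (hE : Roomy E P) (hM : 2 * P.s * total P w ≤ E.M) :
    E.Hoare (fun ρ => Head P w (total P w) ρ ∧ Sample P A ρ) processSample
      (P.n * (44 * P.s + 31) + 60 * P.m + 10 * P.k + 80)
      (fun ρ => (Head P w (total P w) ρ ∧ ¬ GoodSample E P w A) ∨ Reweighted E P w ρ ∨
        Found E P ρ) := by
  have hB := hE.hB
  set post : (ℕ → ℕ) → Prop := fun ρ => (Head P w (total P w) ρ ∧ ¬ GoodSample E P w A) ∨
    Reweighted E P w ρ ∨ Found E P ρ with hpost
  have hsmall : E.Hoare (fun ρ => (Head P w (total P w) ρ ∧ Sample P A ρ ∧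
      (ρ 17 = 0 ↔ A.card ≤ 4 * P.s)) ∧ ρ 17 = 0)
      (.seq coverCheck (.ifPos 21 reweight (.const 12 0)))
      (P.n * (44 * P.s + 31) + 60 * P.m + 10 * P.k + 70) post := by
    by_cases hA : A.card ≤ 4 * P.s
    swap
    · exact fun t K c ρ _ h => absurd (h.1.2.2.mp h.2) hA
    refine Env.Hoare.conseq (Env.Hoare.seq (hoare_coverCheck hE hA)
      (Env.Hoare.ifPos (T := 60 * P.m + 10 * P.k + 50) ?_ (Env.hoare_of_wp ?_ ?_)))
      (fun ρ _ h => ⟨h.1.1, h.1.2.1⟩)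
      (T' := P.n * (44 * P.s + 31) + 60 * P.m + 10 * P.k + 70) ?_ (fun ρ _ h => h)
    · rintro t K c ρ hw ⟨⟨hH, hS, hC⟩, hpos⟩ hc
      obtain ⟨h, _⟩ | ⟨x, hx, hxr, hA'⟩ := hC
      · omega
      refine hoare_reweight hE hM hx t K c ρ hw ⟨hH, hxr⟩ fun ρ' hw' h => hc ρ' hw' ?_
      refine h.imp (fun h => ⟨h.1, fun hg => ?_⟩) Or.inl
      obtain ⟨j, hj, hj'⟩ := hg.2 x hx h.2
      rw [hA' j hj] at hj'
      exact absurd hj' (by simp)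
    · rintro ρ _ ⟨⟨hH, hS, hC⟩, h21⟩
      obtain ⟨_, hcov⟩ | ⟨x, hx, hxr, _⟩ := hC
      · refine ⟨by omega, Nat.zero_le _, Or.inr (Or.inr ⟨by simp, by simp [hH.r6], A, by simp [hS],
          hA, fun x hx => hcov x (Nat.zero_le _) hx⟩)⟩
      · omega
    · simp [Env.steps]
    · have : P.n * (11 * (4 * P.s) + 31) = P.n * (44 * P.s + 31) := by ring
      omega
  refine Env.Hoare.conseq (Env.Hoare.seq (mid := fun ρ => Head P w (total P w) ρ ∧ Sample P A ρ ∧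
      (ρ 17 = 0 ↔ A.card ≤ 4 * P.s)) (Env.hoare_of_wp ?_ le_rfl)
    (Env.Hoare.ifPos (Env.hoare_of_wp ?_ ?_) hsmall))
    (fun _ _ h => h) (T' := P.n * (44 * P.s + 31) + 60 * P.m + 10 * P.k + 80) ?_ (fun ρ _ h => h)
  · rintro ρ _ ⟨hH, hS⟩
    simp [Env.wp, hH.r9, hH, hS, hS.card, Nat.sub_eq_zero_iff_le]
    omega
  · rintro ρ _ ⟨⟨hH, hS, h17⟩, hpos⟩
    exact Or.inl ⟨hH, fun h => by have := h17.mpr h.1; omega⟩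
  · simp only [Env.steps]; omega
  · simp only [Env.steps]; omega

/-! ### Sampling -/

/-- Writing to the sample does not affect the permanent part of the memory. -/
theorem Head.of_agree {W : ℕ} {ρ ρ' : ℕ → ℕ} (h : Head P w W ρ)
    (hρ : ∀ i, i < 13 ∨ 32 ≤ i → i < 32 + 2 * P.m → ρ' i = ρ i) : Head P w W ρ' := by
  constructor
  all_goals first
    | intro j hj
      rw [hρ _ (by omega) (by omega)]
      first | exact h.hw j hj | exact h.hv j hj
    | rw [hρ _ (by omega) (by omega)]
      cases h
      assumption

theorem Sample.insert {ρ ρ' : ℕ → ℕ} (h : Sample P A ρ) {r : ℕ} (hr : r < P.m) (hA : r ∉ A)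
    (h16 : ρ' 16 = A.card + 1) (h1 : ρ' (32 + 2 * P.m + A.card) = r)
    (h2 : ∀ i < A.card, ρ' (32 + 2 * P.m + i) = ρ (32 + 2 * P.m + i)) :
    Sample P (insert r A) ρ' := by
  refine ⟨by rw [h16, Finset.card_insert_of_notMem hA], ?_, ?_⟩
  · exact Finset.insert_subset (Finset.mem_range.mpr hr) h.sub
  · rw [h16, Finset.range_add_one, Finset.image_insert, h1]
    congr 1
    refine h.image.trans ?_
    rw [h.card]
    exact Finset.image_congr fun i hi => (h2 i (by simpa using hi)).symm

/-- The expectation of `c` over the random sets obtained from `A` by inserting each `j < r`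
independently with probability `p j`; the complementary probability is `q j`. -/
noncomputable def mix (p q : ℕ → ℝ≥0∞) (c : Finset ℕ → ℝ≥0∞) : ℕ → Finset ℕ → ℝ≥0∞
  | 0, A => c A
  | r + 1, A => p r * mix p q c r (insert r A) + q r * mix p q c r A

/-- The probability that a uniformly random number below `W` is less than `u`. -/
noncomputable def hit (u W : ℕ) : ℝ≥0∞ := (min u W : ℕ) / W

/-- The probability that a uniformly random number below `W` is at least `u`. -/
noncomputable def miss (u W : ℕ) : ℝ≥0∞ := (W - min u W : ℕ) / W

theorem average_ite {u W : ℕ} (a b : ℝ≥0∞) :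
    (W : ℝ≥0∞)⁻¹ * ∑ v ∈ Finset.range W, (if v < u then a else b) =
      hit u W * a + miss u W * b := by
  have h1 : (Finset.range W).filter (fun v => v < u) = Finset.range (min u W) := by
    ext v; simp [and_comm]
  have h2 : ((Finset.range W).filter (fun v => ¬ v < u)).card = W - min u W := by
    have := Finset.card_filter_add_card_filter_not (s := Finset.range W) (fun v => v < u)
    rw [h1] at this
    simp only [Finset.card_range] at this
    omega
  rw [Finset.sum_ite, Finset.sum_const, Finset.sum_const, h1, h2, Finset.card_range, nsmul_eq_mul,
    nsmul_eq_mul, hit, miss, ENNReal.div_eq_inv_mul, ENNReal.div_eq_inv_mul]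
  ring

theorem hit_add_miss {u W : ℕ} (hW : 0 < W) : hit u W + miss u W = 1 := by
  rw [hit, miss, ← ENNReal.add_div, ← Nat.cast_add, Nat.add_sub_cancel' (min_le_right _ _)]
  exact ENNReal.div_self (by simp; omega) (by simp)

/-- The sampling loop, with the sets below `r` left and the sample `A` so far. -/
def SampleInv (P : Params) (w : ℕ → ℕ) (r : ℕ) (A : Finset ℕ) (ρ : ℕ → ℕ) : Prop :=
  Head P w (total P w) ρ ∧ Sample P A ρ ∧ ρ 13 = r ∧ r ≤ P.m ∧ ∀ j ∈ A, r ≤ j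

theorem hoare_insertSample (hE : Roomy E P) {r v : ℕ} (hr : r < P.m) :
    E.Hoare (fun ρ => Head P w (total P w) ρ ∧ Sample P A ρ ∧ ρ 13 = r ∧ (∀ j ∈ A, r + 1 ≤ j) ∧
        ρ 17 = v)
      (block [.add 14 5 13, .load 15 14, .sub 15 15 17,
        .ifPos 15 (block [.add 14 6 16, .store 14 13, .add 16 16 3]) .skip]) 13
      (SampleInv P w r (if v < P.s * w r then insert r A else A)) := by
  have hB := hE.hB
  have hm := hE.hm
  refine Env.hoare_of_wp ?_ (by simp [block, Env.steps])
  rintro ρ _ ⟨hH, hS, h13, hA, h17⟩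
  have h1 : 32 + P.m + r ≤ E.M := by omega
  have hvr := hH.hv r hr
  have hrA : r ∉ A := fun h => by have := hA r h; omega
  have hcard : A.card < P.m := by
    have := Finset.card_le_card (Finset.insert_subset (Finset.mem_range.mpr hr) hS.sub)
    rwa [Finset.card_insert_of_notMem hrA, Finset.card_range] at this
  by_cases hv : v < P.s * w r
  · have h2 : 32 + 2 * P.m + A.card ≤ E.M := by omega
    have h3 : A.card + 1 ≤ E.M := by omega
    have hne : ¬ P.s * w r ≤ v := by omega
    simp [block, Env.wp, hB, hH.r5, hH.r6, hH.r3, h13, h17, h1, hvr, hv, hne, h2, h3, hS.card,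
      SampleInv, Nat.sub_eq_zero_iff_le]
    refine ⟨by omega, by omega, by omega, by omega, by omega, ?_, ?_, by omega, fun j hj => ?_⟩
    · refine hH.of_agree fun i hi hi' => ?_
      repeat rw [Function.update_of_ne (by omega)]
    · refine hS.insert hr hrA ?_ ?_ fun i hi => ?_
      · simp
      · simp
      · repeat rw [Function.update_of_ne (by omega)]
    · have := hA j hj; omega
  · have hle : P.s * w r ≤ v := by omega
    simp [block, Env.wp, hB, hH.r5, h13, h17, h1, hvr, hv, hle, SampleInv, hH, hS]
    exact ⟨by omega, by omega, by omega, fun j hj => by have := hA j hj; omega⟩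

/-- The sampling loop averages over the random sample. -/
theorem val_sampleLoop_le (hE : Roomy E P) (hW : 0 < total P w) {t : ℕ}
    {K : List Program} {c : Finset ℕ → ℝ≥0∞}
    (hc : ∀ A ρ, E.Within ρ → Head P w (total P w) ρ ∧ Sample P A ρ → E.val t K ρ ≤ c A)
    (r : ℕ) (A : Finset ℕ) (ρ : ℕ → ℕ) (hw : E.Within ρ) (h : SampleInv P w r A ρ) :
    E.val t (.whilePos 13 sampleBody :: K) ρ ≤ ((r * 20 + 1) * E.unit : ℕ) +
      mix (fun j => hit (P.s * w j) (total P w)) (fun j => miss (P.s * w j) (total P w)) c r A := by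
  induction r generalizing A ρ with
  | zero =>
    refine (Env.val_while_zero hw h.2.2.1).trans ?_
    simpa [mix] using hc A ρ hw ⟨h.1, h.2.1⟩
  | succ r ih =>
    obtain ⟨hH, hS, h13, hr, hA⟩ := h
    have hB := hE.hB
    set p : ℕ → ℝ≥0∞ := fun j => hit (P.s * w j) (total P w)
    set q : ℕ → ℝ≥0∞ := fun j => miss (P.s * w j) (total P w)
    set K' : List Program := .whilePos 13 sampleBody :: K
    set ρ₁ := Function.update ρ 13 r with hρ₁
    have hw₁ : E.Within ρ₁ := hw.update (by omega) (by have := hw.1 13; omega)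
    have hH₁ : Head P w (total P w) ρ₁ := by simp [hρ₁, hH]
    have hS₁ : Sample P A ρ₁ := by simp [hρ₁, hS]
    have h13₁ : ρ₁ 13 = r := by simp [hρ₁]
    have hpos : 0 < ρ₁ 10 := by rw [hH₁.r10]; exact hW
    set rest := block [.add 14 5 13, .load 15 14, .sub 15 15 17,
        .ifPos 15 (block [.add 14 6 16, .store 14 13, .add 16 16 3]) .skip] with hrest
    have key : ∀ v ∈ Finset.range (total P w), E.val t (rest :: K') (Function.update ρ₁ 17 v) ≤
        (((13 + (r * 20 + 1)) * E.unit : ℕ) : ℝ≥0∞) +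
          if v < P.s * w r then mix p q c r (insert r A) else mix p q c r A := by
      intro v hv
      have hvM : v ≤ E.M := by
        have := hw₁.1 10
        rw [hH₁.r10] at this
        have := Finset.mem_range.mp hv
        omega
      refine (hoare_insertSample (A := A) (v := v) (w := w) hE hr t K' _ _
        (hw₁.update (by omega) hvM) ?_ fun ρ' hw' h' => ih _ ρ' hw' h').trans (le_of_eq ?_)
      · simp [hH₁, hS₁, h13₁]
        exact fun j hj => hA j hj
      · split_ifs <;> (push_cast; ring)
    have havg : (total P w : ℝ≥0∞)⁻¹ * ∑ v ∈ Finset.range (total P w),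
        E.val t (rest :: K') (Function.update ρ₁ 17 v) ≤
        (((13 + (r * 20 + 1)) * E.unit : ℕ) : ℝ≥0∞) + mix p q c (r + 1) A := by
      calc _ ≤ (total P w : ℝ≥0∞)⁻¹ * ∑ v ∈ Finset.range (total P w),
            ((((13 + (r * 20 + 1)) * E.unit : ℕ) : ℝ≥0∞) +
              if v < P.s * w r then mix p q c r (insert r A) else mix p q c r A) := by
            gcongr with v hv
            exact key v hv
        _ = _ := by
            rw [Finset.sum_add_distrib, mul_add, average_ite, Finset.sum_const, Finset.card_range,
              nsmul_eq_mul, ← mul_assoc, ENNReal.inv_mul_cancel (by simp; omega) (by simp), one_mul]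
            rfl
    calc E.val t (.whilePos 13 sampleBody :: K) ρ
        ≤ E.unit + E.val t (sampleBody :: K') ρ := Env.val_while_pos hw (by omega)
      _ ≤ E.unit + (E.unit + E.val t (.sub 13 13 3 :: .seq (.rand 17 10) rest :: K') ρ) := by
          gcongr
          exact Env.val_cons_le hw (by simp [sampleBody]) rfl
      _ ≤ E.unit + (E.unit + (E.unit + E.val t (.seq (.rand 17 10) rest :: K') ρ₁)) := by
          gcongr
          refine Env.val_cons_le hw (by simp) ?_
          simp [step, hρ₁, h13, hH.r3]
      _ ≤ E.unit + (E.unit + (E.unit + (E.unit + E.val t (.rand 17 10 :: rest :: K') ρ₁))) := by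
          gcongr
          exact Env.val_cons_le hw₁ (by simp) rfl
      _ ≤ E.unit + (E.unit + (E.unit + (E.unit + (E.unit +
          ((((13 + (r * 20 + 1)) * E.unit : ℕ) : ℝ≥0∞) + mix p q c (r + 1) A))))) := by
          gcongr
          refine (Env.val_rand_le hw₁ hpos).trans ?_
          rw [hH₁.r10]
          gcongr
      _ = (((5 + 13 + (r * 20 + 1)) * E.unit : ℕ) : ℝ≥0∞) + mix p q c (r + 1) A := by
          push_cast
          ring
      _ ≤ _ :=
          add_le_add (Nat.cast_le.mpr (Nat.mul_le_mul_right _ (by omega))) le_rfl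

end Rounds

/-! ### The probability of a good sample -/

section Probability

variable {p q : ℕ → ℝ≥0∞}

theorem mix_mono {c c' : Finset ℕ → ℝ≥0∞} (h : ∀ A, c A ≤ c' A) (r : ℕ) (A : Finset ℕ) :
    mix p q c r A ≤ mix p q c' r A := by
  induction r generalizing A with
  | zero => exact h A
  | succ r ih => exact add_le_add (by gcongr; exact ih _) (by gcongr; exact ih _)

theorem mix_add (c c' : Finset ℕ → ℝ≥0∞) (r : ℕ) (A : Finset ℕ) :
    mix p q (fun A => c A + c' A) r A = mix p q c r A + mix p q c' r A := by
  induction r generalizing A with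
  | zero => rfl
  | succ r ih => simp only [mix, ih]; ring

theorem mix_const_mul (b : ℝ≥0∞) (c : Finset ℕ → ℝ≥0∞) (r : ℕ) (A : Finset ℕ) :
    mix p q (fun A => b * c A) r A = b * mix p q c r A := by
  induction r generalizing A with
  | zero => rfl
  | succ r ih => simp only [mix, ih]; ring

theorem mix_sum {ι : Type*} (s : Finset ι) (c : ι → Finset ℕ → ℝ≥0∞) (r : ℕ) (A : Finset ℕ) :
    mix p q (fun A => ∑ x ∈ s, c x A) r A = ∑ x ∈ s, mix p q (c x) r A := by
  induction r generalizing A with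
  | zero => rfl
  | succ r ih => simp only [mix, ih, Finset.mul_sum, Finset.sum_add_distrib]

theorem mix_const (h : ∀ j, p j + q j = 1) (b : ℝ≥0∞) (r : ℕ) (A : Finset ℕ) :
    mix p q (fun _ => b) r A = b := by
  induction r generalizing A with
  | zero => rfl
  | succ r ih => simp only [mix, ih, ← add_mul, h, one_mul]

theorem mix_card_le (h : ∀ j, p j + q j = 1) (r : ℕ) (A : Finset ℕ) :
    mix p q (fun A => (A.card : ℝ≥0∞)) r A ≤ A.card + ∑ j ∈ Finset.range r, p j := by
  induction r generalizing A with
  | zero => simp [mix]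
  | succ r ih =>
    have hins : ((insert r A).card : ℝ≥0∞) ≤ A.card + 1 := by
      exact_mod_cast Finset.card_insert_le r A
    calc mix p q (fun A => (A.card : ℝ≥0∞)) (r + 1) A
        ≤ p r * ((A.card + 1) + ∑ j ∈ Finset.range r, p j) +
            q r * (A.card + ∑ j ∈ Finset.range r, p j) := by
          refine add_le_add ?_ ?_
          · gcongr
            exact (ih _).trans (add_le_add hins le_rfl)
          · gcongr
            exact ih _
      _ = (p r + q r) * (A.card + ∑ j ∈ Finset.range r, p j) + p r := by ring
      _ = _ := by rw [h, one_mul, Finset.sum_range_succ, add_assoc]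

/-- The probability that no element of `S` is inserted. -/
theorem mix_miss_le (h : ∀ j, p j + q j = 1) (S : ℕ → Prop) [DecidablePred S] (r : ℕ)
    (A : Finset ℕ) :
    mix p q (fun A => if ∀ j ∈ A, ¬ S j then 1 else 0) r A ≤
      if ∀ j ∈ A, ¬ S j then ∏ j ∈ Finset.range r, (if S j then q j else 1) else 0 := by
  induction r generalizing A with
  | zero => simp [mix]
  | succ r ih =>
    rw [mix]
    refine (add_le_add (mul_le_mul_right (ih (insert r A)) _)
      (mul_le_mul_right (ih A) _)).trans (le_of_eq ?_)
    rw [Finset.prod_range_succ]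
    by_cases hA : ∀ j ∈ A, ¬ S j
    · by_cases hr : S r
      · rw [if_pos hA, if_neg (by simp [hr]), if_pos hr, if_pos hA]
        ring
      · have hA' : ∀ j ∈ insert r A, ¬ S j := by
          intro j hj
          rcases Finset.mem_insert.mp hj with rfl | hj
          · exact hr
          · exact hA j hj
        rw [if_pos hA, if_pos hA', if_neg hr, ← add_mul, h, if_pos hA]
        ring
    · have hA' : ¬ ∀ j ∈ insert r A, ¬ S j := fun h' => hA fun j hj =>
        h' j (Finset.mem_insert_of_mem hj)
      rw [if_neg hA, if_neg hA', if_neg hA]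
      simp

theorem hit_le (u W : ℕ) : hit u W ≤ (u : ℝ≥0∞) / W := by
  unfold hit
  gcongr
  exact min_le_left _ _

theorem miss_le_exp {u W : ℕ} (hW : 0 < W) :
    miss u W ≤ ENNReal.ofReal (Real.exp (-((u : ℝ) / W))) := by
  have hW' : (0 : ℝ) < W := by exact_mod_cast hW
  have h1 : miss u W = ENNReal.ofReal (((W - min u W : ℕ) : ℝ) / W) := by
    rw [miss, ENNReal.ofReal_div_of_pos hW', ENNReal.ofReal_natCast, ENNReal.ofReal_natCast]
  rw [h1]
  apply ENNReal.ofReal_le_ofReal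
  rcases le_total u W with h | h
  · rw [min_eq_left h, Nat.cast_sub h, sub_div, div_self hW'.ne']
    linarith [Real.add_one_le_exp (-((u : ℝ) / W))]
  · rw [min_eq_right h]
    simp [Real.exp_nonneg]

variable {E : Env} {P : Params} {w : ℕ → ℕ}

theorem sum_hit_le (hW : 0 < total P w) :
    ∑ j ∈ Finset.range P.m, hit (P.s * w j) (total P w) ≤ P.s := by
  calc _ ≤ ∑ j ∈ Finset.range P.m, ((P.s * w j : ℕ) : ℝ≥0∞) / (total P w) :=
        Finset.sum_le_sum fun j _ => hit_le _ _
    _ = ((P.s * total P w : ℕ) : ℝ≥0∞) / (total P w) := by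
        simp only [div_eq_mul_inv]
        rw [← Finset.sum_mul, total, Finset.mul_sum]
        push_cast
        rfl
    _ = P.s := by
        rw [Nat.cast_mul, mul_div_assoc, ENNReal.div_self (by simp; omega) (by simp), mul_one]

/-- An element that is not light is missed by the sample with probability at most
`exp (-l) ≤ 2 ^ (-l) ≤ 1 / (4 n)`. -/
theorem prod_miss_le (hW : 0 < total P w) (hn : 0 < P.n) (hl : 4 * P.n ≤ 2 ^ P.l) {x : ℕ}
    (hx : ¬ Light E P w x) :
    ∏ j ∈ Finset.range P.m, (if E.O.answer x j then miss (P.s * w j) (total P w) else 1) ≤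
      ((4 * P.n : ℕ) : ℝ≥0∞)⁻¹ := by
  have hW' : (0 : ℝ) < total P w := by exact_mod_cast hW
  have hsum : (P.l : ℝ) ≤ ∑ j ∈ Finset.range P.m,
      (if E.O.answer x j then (((P.s * w j : ℕ) : ℝ) / total P w) else 0) := by
    have h1 : ∑ j ∈ Finset.range P.m,
        (if E.O.answer x j then (((P.s * w j : ℕ) : ℝ) / total P w) else 0) =
        ((P.s * weightFrom E P w x 0 : ℕ) : ℝ) / total P w := by
      rw [weightFrom, Finset.mul_sum, Nat.cast_sum, Finset.sum_div, Finset.range_eq_Ico]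
      refine Finset.sum_congr rfl fun j _ => ?_
      split_ifs <;> simp
    rw [h1, le_div_iff₀ hW']
    have h2 : total P w < 2 * P.k * weightFrom E P w x 0 := not_le.mp hx
    have h3 : P.l * total P w ≤ P.s * weightFrom E P w x 0 := by
      calc P.l * total P w ≤ P.l * (2 * P.k * weightFrom E P w x 0) :=
            Nat.mul_le_mul_left _ h2.le
        _ = _ := by unfold Params.s; ring
    exact_mod_cast h3
  have hexp : Real.exp (-(P.l : ℝ)) ≤ ((4 * P.n : ℕ) : ℝ)⁻¹ := by
    rw [Real.exp_neg]
    apply inv_anti₀ (by positivity)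
    calc ((4 * P.n : ℕ) : ℝ) ≤ ((2 ^ P.l : ℕ) : ℝ) := by exact_mod_cast hl
      _ = 2 ^ P.l := by push_cast; rfl
      _ ≤ Real.exp 1 ^ P.l := by
          gcongr
          linarith [Real.add_one_le_exp 1]
      _ = Real.exp P.l := by rw [← Real.exp_nat_mul, mul_one]
  calc _ ≤ ∏ j ∈ Finset.range P.m, ENNReal.ofReal (Real.exp
        (-(if E.O.answer x j then (((P.s * w j : ℕ) : ℝ) / total P w) else 0))) := by
        refine Finset.prod_le_prod' fun j _ => ?_
        split_ifs
        · exact miss_le_exp hW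
        · simp
    _ = ENNReal.ofReal (Real.exp (-∑ j ∈ Finset.range P.m,
        (if E.O.answer x j then (((P.s * w j : ℕ) : ℝ) / total P w) else 0))) := by
        rw [← ENNReal.ofReal_prod_of_nonneg fun _ _ => Real.exp_nonneg _, ← Real.exp_sum,
          Finset.sum_neg_distrib]
    _ ≤ ENNReal.ofReal ((4 * P.n : ℕ) : ℝ)⁻¹ := by
        apply ENNReal.ofReal_le_ofReal
        refine le_trans ?_ hexp
        gcongr
    _ = _ := by
        rw [ENNReal.ofReal_inv_of_pos (by positivity), ENNReal.ofReal_natCast]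

open Classical in
/-- A sample is good with probability at least one half: it is too large with probability at most
`1 / 4` by Markov's inequality, and each of the at most `n` elements that are not light is missed
with probability at most `1 / (4 n)`. -/
theorem mix_bad_le (hW : 0 < total P w) (hn : 0 < P.n) (hl : 4 * P.n ≤ 2 ^ P.l) (hs : 0 < P.s) :
    mix (fun j => hit (P.s * w j) (total P w)) (fun j => miss (P.s * w j) (total P w))
      (fun A => if GoodSample E P w A then 0 else 1) P.m ∅ ≤ 2⁻¹ := by
  set p : ℕ → ℝ≥0∞ := fun j => hit (P.s * w j) (total P w)
  set q : ℕ → ℝ≥0∞ := fun j => miss (P.s * w j) (total P w)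
  have hpq : ∀ j, p j + q j = 1 := fun j => hit_add_miss hW
  set heavy := (Finset.range P.n).filter fun x => ¬ Light E P w x
  have hbad : ∀ A : Finset ℕ, (if GoodSample E P w A then (0 : ℝ≥0∞) else 1) ≤
      ((4 * P.s : ℕ) : ℝ≥0∞)⁻¹ * A.card +
        ∑ x ∈ heavy, if ∀ j ∈ A, ¬ E.O.answer x j = true then 1 else 0 := by
    intro A
    split_ifs with hg
    · exact zero_le
    rw [GoodSample, not_and_or] at hg
    rcases hg with hg | hg
    · refine le_add_right ?_
      rw [← ENNReal.div_eq_inv_mul, ENNReal.le_div_iff_mul_le (by simp; omega) (by simp), one_mul]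
      exact_mod_cast (not_le.mp hg).le
    · push Not at hg
      obtain ⟨x, hx, hxl, hA⟩ := hg
      refine le_add_left ?_
      have hmem : x ∈ heavy := Finset.mem_filter.mpr ⟨Finset.mem_range.mpr hx, hxl⟩
      refine le_trans ?_ (Finset.single_le_sum (fun _ _ => zero_le) hmem)
      rw [if_pos hA]
  have h4 : (4 : ℝ≥0∞) ≠ 0 := by norm_num
  have h4' : (4 : ℝ≥0∞) ≠ ⊤ := by norm_num
  have hcancel : ∀ a : ℕ, 0 < a → ((4 * a : ℕ) : ℝ≥0∞)⁻¹ * a = 4⁻¹ := by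
    intro a ha
    rw [Nat.cast_mul, ENNReal.mul_inv (by simp) (by simp), mul_assoc,
      ENNReal.inv_mul_cancel (by simp; omega) (by simp), mul_one]
    rfl
  calc _ ≤ mix p q (fun A : Finset ℕ => ((4 * P.s : ℕ) : ℝ≥0∞)⁻¹ * A.card +
        ∑ x ∈ heavy, if ∀ j ∈ A, ¬ E.O.answer x j = true then 1 else 0) P.m ∅ :=
        mix_mono hbad _ _
    _ = ((4 * P.s : ℕ) : ℝ≥0∞)⁻¹ * mix p q (fun A => (A.card : ℝ≥0∞)) P.m ∅ +
        ∑ x ∈ heavy,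
          mix p q (fun A => if ∀ j ∈ A, ¬ E.O.answer x j = true then 1 else 0) P.m ∅ := by
        rw [mix_add, mix_const_mul, mix_sum]
    _ ≤ ((4 * P.s : ℕ) : ℝ≥0∞)⁻¹ * P.s + ∑ x ∈ heavy, ((4 * P.n : ℕ) : ℝ≥0∞)⁻¹ := by
        refine add_le_add ?_ (Finset.sum_le_sum fun x hx => ?_)
        · gcongr
          refine (mix_card_le hpq _ _).trans ?_
          simpa using sum_hit_le hW
        · refine (mix_miss_le hpq (fun j => E.O.answer x j = true) _ _).trans ?_
          rw [if_pos (by simp)]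
          exact prod_miss_le hW hn hl (Finset.mem_filter.mp hx).2
    _ ≤ ((4 * P.s : ℕ) : ℝ≥0∞)⁻¹ * P.s + ((4 * P.n : ℕ) : ℝ≥0∞)⁻¹ * P.n := by
        gcongr
        rw [Finset.sum_const, nsmul_eq_mul, mul_comm]
        gcongr
        exact_mod_cast (Finset.card_filter_le _ _).trans (by simp)
    _ = 4⁻¹ + 4⁻¹ := by rw [hcancel _ hs, hcancel _ hn]
    _ = 2⁻¹ := by
        rw [← two_mul, show (4 : ℝ≥0∞) = 2 * 2 by norm_num,
          ENNReal.mul_inv (by simp) (by simp), ← mul_assoc,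
          ENNReal.mul_inv_cancel (by simp) (by simp), one_mul]

end Probability

/-! ### The number of reweightings -/

section Progress

variable {E : Env} {P : Params} {w : ℕ → ℕ} {H : Finset ℕ} {i : ℕ}

/-- The set `H` of indices is a cover of size `k`. -/
structure Covers (E : Env) (P : Params) (H : Finset ℕ) : Prop where
  sub : H ⊆ Finset.range P.m
  card : H.card = P.k
  cover : ∀ x < P.n, ∃ j ∈ H, E.O.answer x j

/-- The effect of `i` reweightings: the total weight has grown by a factor of at most
`1 + 1 / (2 k)` each time, whereas the product of the weights in the cover `H` has at least
doubled. -/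
structure Progress (P : Params) (H : Finset ℕ) (w : ℕ → ℕ) (i : ℕ) : Prop where
  total_le : (total P w : ℝ) ≤ P.m * (1 + 1 / (2 * P.k)) ^ i
  le_prod : 2 ^ i ≤ ∏ h ∈ H, w h

theorem progress_zero : Progress P H (fun _ => 1) 0 := by
  constructor <;> simp [total]

theorem Progress.step (h : Progress P H w i) (hH : Covers E P H) (hk : 1 ≤ P.k) {x : ℕ}
    (hx : x < P.n) (hl : Light E P w x) : Progress P H (doubleFrom E x 0 w) (i + 1) := by
  have hk' : (0 : ℝ) < P.k := by exact_mod_cast hk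
  constructor
  · have h1 : (weightFrom E P w x 0 : ℝ) ≤ total P w * (1 / (2 * P.k)) := by
      rw [mul_one_div, le_div_iff₀ (by positivity)]
      have : 2 * P.k * weightFrom E P w x 0 ≤ total P w := hl
      rw [mul_comm]
      exact_mod_cast this
    calc ((total P (doubleFrom E x 0 w) : ℕ) : ℝ)
        = total P w + weightFrom E P w x 0 := by rw [total_doubleFrom]; push_cast; rfl
      _ ≤ total P w * (1 + 1 / (2 * P.k)) := by linarith
      _ ≤ P.m * (1 + 1 / (2 * P.k)) ^ i * (1 + 1 / (2 * P.k)) := by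
          gcongr
          exact h.total_le
      _ = _ := by ring
  · obtain ⟨j, hj, hxj⟩ := hH.cover x hx
    have hge : ∀ a, w a ≤ doubleFrom E x 0 w a := fun a => by
      unfold doubleFrom; split_ifs <;> omega
    have hj2 : doubleFrom E x 0 w j = 2 * w j := if_pos ⟨Nat.zero_le _, hxj⟩
    calc 2 ^ (i + 1) = 2 * 2 ^ i := pow_succ' _ _
      _ ≤ 2 * ∏ h ∈ H, w h := Nat.mul_le_mul_left _ h.le_prod
      _ = (2 * w j) * ∏ h ∈ H.erase j, w h := by rw [mul_assoc, Finset.mul_prod_erase _ _ hj]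
      _ ≤ doubleFrom E x 0 w j * ∏ h ∈ H.erase j, doubleFrom E x 0 w h := by
          rw [hj2]
          exact Nat.mul_le_mul_left _ (Finset.prod_le_prod' fun a _ => hge a)
      _ = _ := Finset.mul_prod_erase _ _ hj

/-- The AM-GM inequality for the weights in the cover. -/
theorem Progress.pow_card_le (h : Progress P H w i) (hH : Covers E P H) (hk : 1 ≤ P.k) :
    (2 : ℝ) ^ i * P.k ^ P.k ≤ (total P w : ℝ) ^ P.k := by
  have hk' : (0 : ℝ) < P.k := by exact_mod_cast hk
  have hcard : ∑ _h ∈ H, (1 : ℝ) = P.k := by simp [hH.card]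
  have hamgm := Real.geom_mean_le_arith_mean H (fun _ => 1) (fun h => (w h : ℝ))
    (fun _ _ => zero_le_one) (by rw [hcard]; exact hk') (fun _ _ => Nat.cast_nonneg _)
  simp only [hcard, Real.rpow_one, one_mul] at hamgm
  rw [Real.rpow_inv_le_iff_of_pos (Finset.prod_nonneg fun _ _ => Nat.cast_nonneg _)
    (div_nonneg (Finset.sum_nonneg fun _ _ => Nat.cast_nonneg _) hk'.le) hk', Real.rpow_natCast,
    div_pow, le_div_iff₀ (by positivity)] at hamgm
  have h2 : (2 : ℝ) ^ i ≤ ∏ h ∈ H, (w h : ℝ) := by exact_mod_cast h.le_prod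
  have h3 : ∑ h ∈ H, (w h : ℝ) ≤ total P w := by
    exact_mod_cast Finset.sum_le_sum_of_subset (f := w) hH.sub
  calc (2 : ℝ) ^ i * P.k ^ P.k ≤ (∏ h ∈ H, (w h : ℝ)) * P.k ^ P.k := by gcongr
    _ ≤ (∑ h ∈ H, (w h : ℝ)) ^ P.k := hamgm
    _ ≤ _ := by gcongr

theorem Progress.total_pos (h : Progress P H w i) (hH : Covers E P H) (hk : 1 ≤ P.k) :
    0 < total P w := by
  rw [Nat.pos_iff_ne_zero]
  intro h0
  have h1 := h.pow_card_le hH hk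
  rw [h0, Nat.cast_zero, zero_pow (by omega)] at h1
  have : (0 : ℝ) < P.k := by exact_mod_cast hk
  exact absurd h1 (not_le.mpr (by positivity))

theorem Progress.total_pow_le (h : Progress P H w i) (hk : 1 ≤ P.k) :
    (total P w : ℝ) ^ P.k ≤ P.m ^ P.k * (5 / 3) ^ i := by
  have hk' : (0 : ℝ) < P.k := by exact_mod_cast hk
  -- `5 / 3` is a rational upper bound for `exp (1 / 2)`.
  have h1 : (1 + 1 / (2 * P.k) : ℝ) ^ P.k ≤ 5 / 3 := by
    have h2 : (1 + 1 / (2 * P.k) : ℝ) ≤ Real.exp (1 / (2 * P.k)) := by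
      linarith [Real.add_one_le_exp (1 / (2 * P.k) : ℝ)]
    have h3 : (1 + 1 / (2 * P.k) : ℝ) ^ P.k ≤ Real.exp (1 / 2) := by
      calc _ ≤ Real.exp (1 / (2 * P.k)) ^ P.k := by gcongr
        _ = Real.exp (1 / 2) := by
            rw [← Real.exp_nat_mul]
            congr 1
            field_simp
    refine h3.trans (abs_le_of_sq_le_sq' ?_ (by norm_num)).2
    rw [← Real.exp_nat_mul]
    norm_num
    linarith [Real.exp_one_lt_d9]
  calc (total P w : ℝ) ^ P.k ≤ (P.m * (1 + 1 / (2 * P.k)) ^ i) ^ P.k := by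
        gcongr
        exact h.total_le
    _ = P.m ^ P.k * ((1 + 1 / (2 * P.k)) ^ P.k) ^ i := by
        rw [mul_pow, ← pow_mul, ← pow_mul, mul_comm i]
    _ ≤ _ := by gcongr

/-- Comparing the growth of the total weight with that of the cover bounds the number of
reweightings. -/
theorem Progress.pow_le (h : Progress P H w i) (hH : Covers E P H) (hk : 1 ≤ P.k) :
    (6 / 5 : ℝ) ^ i ≤ ((P.m : ℝ) / P.k) ^ P.k := by
  have hk' : (0 : ℝ) < P.k := by exact_mod_cast hk
  have h1 := (h.pow_card_le hH hk).trans (h.total_pow_le hk)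
  rw [div_pow (P.m : ℝ), le_div_iff₀ (by positivity)]
  have h2 : (2 : ℝ) ^ i = (6 / 5) ^ i * (5 / 3) ^ i := by rw [← mul_pow]; norm_num
  rw [h2] at h1
  have h3 : (0 : ℝ) < (5 / 3) ^ i := by positivity
  refine le_of_mul_le_mul_right ?_ h3
  linarith

theorem Progress.total_le_pow (h : Progress P H w i) (hH : Covers E P H) (hk : 1 ≤ P.k) :
    total P w ≤ P.m ^ 4 := by
  have hk' : (1 : ℝ) ≤ P.k := by exact_mod_cast hk
  have h1 : (total P w : ℝ) ^ P.k ≤ ((P.m : ℝ) ^ 4) ^ P.k := by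
    calc (total P w : ℝ) ^ P.k ≤ P.m ^ P.k * (5 / 3) ^ i := h.total_pow_le hk
      _ ≤ P.m ^ P.k * ((6 / 5) ^ 3) ^ i := by gcongr; norm_num
      _ = P.m ^ P.k * ((6 / 5) ^ i) ^ 3 := by rw [← pow_mul, ← pow_mul, mul_comm 3]
      _ ≤ P.m ^ P.k * (((P.m : ℝ) / P.k) ^ P.k) ^ 3 := by
          gcongr
          exact h.pow_le hH hk
      _ ≤ P.m ^ P.k * ((P.m : ℝ) ^ P.k) ^ 3 := by
          gcongr
          exact div_le_self (by positivity) hk'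
      _ = _ := by ring
  exact_mod_cast le_of_pow_le_pow_left₀ (by omega) (by positivity) h1

/-- An upper bound for the number of reweightings. -/
noncomputable def maxSteps (P : Params) : ℕ := ⌊4 * P.k * Real.logb 2 ((P.m : ℝ) / P.k)⌋₊

theorem Progress.le_maxSteps (h : Progress P H w i) (hH : Covers E P H) (hk : 1 ≤ P.k)
    (hm : 1 ≤ P.m) : i ≤ maxSteps P := by
  have hk' : (0 : ℝ) < P.k := by exact_mod_cast hk
  have hm' : (0 : ℝ) < P.m := by exact_mod_cast hm
  apply Nat.le_floor
  have h1 : (2 : ℝ) ^ i ≤ ((P.m : ℝ) / P.k) ^ (4 * P.k) := by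
    calc (2 : ℝ) ^ i ≤ ((6 / 5) ^ 4) ^ i := by gcongr; norm_num
      _ = ((6 / 5) ^ i) ^ 4 := by rw [← pow_mul, ← pow_mul, mul_comm 4]
      _ ≤ (((P.m : ℝ) / P.k) ^ P.k) ^ 4 := by
          gcongr
          exact h.pow_le hH hk
      _ = _ := by rw [← pow_mul, mul_comm 4]
  have h2 := Real.logb_le_logb_of_le (b := 2) (by norm_num) (by positivity) h1
  rw [Real.logb_pow, Real.logb_pow, Real.logb_self_eq_one (by norm_num)] at h2
  push_cast at h2
  linarith

end Progress

/-! ### Expected running time -/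

section Time

variable {E : Env} {P : Params} {w : ℕ → ℕ} {H : Finset ℕ}

/-- A bound on the number of steps of a round. -/
def roundTime (P : Params) : ℕ := P.n * (44 * P.s + 31) + 80 * P.m + 10 * P.k + 100

theorem Roomy.s_pos (hE : Roomy E P) : 0 < P.s := by
  have := hE.two_mul_le
  have := hE.hk
  omega

/-- In a round, at least half of the probability leads to a reweighting or to a cover. -/
theorem val_round_le (hE : Roomy E P) (hn : 0 < P.n) (hl : 4 * P.n ≤ 2 ^ P.l)
    (hW : 0 < total P w) (hM : 2 * P.s * total P w ≤ E.M) {t : ℕ} {K : List Program}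
    {a e : ℝ≥0∞}
    (hstay : ∀ ρ, E.Within ρ → Head P w (total P w) ρ → E.val t K ρ ≤ a + e)
    (hnext : ∀ ρ, E.Within ρ → Reweighted E P w ρ → E.val t K ρ ≤ a)
    (hfound : ∀ ρ, E.Within ρ → Found E P ρ → E.val t K ρ ≤ a)
    {ρ : ℕ → ℕ} (hw : E.Within ρ) (hH : Head P w (total P w) ρ) :
    E.val t (roundBody :: K) ρ ≤ ((roundTime P * E.unit : ℕ) : ℝ≥0∞) + (a + e * 2⁻¹) := by
  classical
  have hB := hE.hB
  have hm := hE.hm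
  set Tp := P.n * (44 * P.s + 31) + 60 * P.m + 10 * P.k + 80 with hTp
  set bad : Finset ℕ → ℝ≥0∞ := fun A => if GoodSample E P w A then 0 else 1 with hbad
  set c : Finset ℕ → ℝ≥0∞ := fun A => (((Tp * E.unit : ℕ) : ℝ≥0∞) + a) + e * bad A with hc
  have hproc : ∀ A ρ, E.Within ρ → Head P w (total P w) ρ ∧ Sample P A ρ →
      E.val t (processSample :: K) ρ ≤ c A := by
    intro A ρ hw hρ
    refine (hoare_processSample hE hM t K (a + e * bad A) ρ hw hρ ?_).trans
      (le_of_eq (add_assoc _ _ _).symm)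
    rintro ρ' hw' (⟨h1, h2⟩ | h | h)
    · rw [hbad]
      simp only [if_neg h2, mul_one]
      exact hstay ρ' hw' h1
    · exact (hnext ρ' hw' h).trans le_self_add
    · exact (hfound ρ' hw' h).trans le_self_add
  have hmix : mix (fun j => hit (P.s * w j) (total P w)) (fun j => miss (P.s * w j) (total P w))
      c P.m ∅ ≤ (((Tp * E.unit : ℕ) : ℝ≥0∞) + a) + e * 2⁻¹ := by
    rw [hc, mix_add, mix_const fun j => hit_add_miss hW, mix_const_mul]
    gcongr
    exact mix_bad_le hW hn hl hE.s_pos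
  have hloop : E.Hoare (Head P w (total P w)) (block [.const 16 0, .const 13 0, .add 13 13 1]) 5
      (SampleInv P w P.m ∅) := by
    refine Env.hoare_of_wp ?_ (by simp [block, Env.steps])
    intro ρ _ hH
    have h1 : P.m ≤ E.M := by omega
    have hS : Sample P ∅ (Function.update ρ 16 0) := ⟨by simp, by simp, by simp⟩
    have hH' : Head P w (total P w) (Function.update ρ 16 0) := hH.update_temp (by omega)
      (by omega) _
    simp [block, Env.wp, hB, hH.r1, h1, SampleInv, hH', hS]
    omega
  calc E.val t (roundBody :: K) ρ
      ≤ E.unit + E.val t (block [.const 16 0, .const 13 0, .add 13 13 1] ::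
          .seq (.whilePos 13 sampleBody) processSample :: K) ρ :=
        Env.val_cons_le hw (by simp [roundBody]) rfl
    _ ≤ E.unit + (((5 * E.unit : ℕ) : ℝ≥0∞) + (E.unit + (((P.m * 20 + 1) * E.unit : ℕ) +
          ((((Tp * E.unit : ℕ) : ℝ≥0∞) + a) + e * 2⁻¹)))) := by
        gcongr
        refine hloop t _ _ ρ hw hH fun ρ' hw' hI => ?_
        refine (Env.val_cons_le hw' (by simp) rfl).trans ?_
        gcongr
        refine (val_sampleLoop_le hE hW hproc P.m ∅ ρ' hw' hI).trans ?_
        gcongr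
    _ = ((((1 + 5 + 1 + (P.m * 20 + 1) + Tp) * E.unit : ℕ) : ℝ≥0∞)) + (a + e * 2⁻¹) := by
        push_cast
        ring
    _ ≤ _ := by
        gcongr
        rw [roundTime]
        omega

/-- The expected time of the main loop: two rounds in expectation for every reweighting that is
still possible, and for the final success. -/
theorem val_mainLoop_le (hE : Roomy E P) (hn : 0 < P.n) (hl : 4 * P.n ≤ 2 ^ P.l)
    (hM : 2 * P.s * P.m ^ 4 ≤ E.M) (hH : Covers E P H) (hm : 1 ≤ P.m) {K : List Program}
    {b : ℝ≥0∞} {t : ℕ} (hK : ∀ ρ, E.Within ρ → Found E P ρ → E.val t K ρ ≤ b) (i : ℕ) (w : ℕ → ℕ)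
    (hi : Progress P H w i) (ρ : ℕ → ℕ) (hw : E.Within ρ) (hρ : Head P w (total P w) ρ) :
    E.val t (.whilePos 12 roundBody :: K) ρ ≤
      ((((maxSteps P + 1 - i) * (2 * (roundTime P + 1))) * E.unit : ℕ) : ℝ≥0∞) + (E.unit + b) := by
  induction t generalizing i w ρ with
  | zero => simp [Env.val, value]
  | succ t ih =>
    have hk := hE.hk
    have hle := hi.le_maxSteps hH hk hm
    have hK' : ∀ ρ, E.Within ρ → Found E P ρ → E.val t K ρ ≤ b := fun ρ hw hρ =>
      (E.val_mono t.le_succ _ _).trans (hK ρ hw hρ)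
    have hMw : 2 * P.s * total P w ≤ E.M :=
      (Nat.mul_le_mul_left _ (hi.total_le_pow hH hk)).trans hM
    -- A potential of `D` per reweighting pays for the rounds: a round and the test of the loop cost
    -- `D / 2`, and with probability at most `1 / 2` the potential does not drop.
    set D := 2 * (roundTime P + 1) with hD
    have hsub : maxSteps P + 1 - i = (maxSteps P - i) + 1 := by omega
    have hround := val_round_le (t := t) (K := .whilePos 12 roundBody :: K)
      (a := ((((maxSteps P - i) * D) * E.unit : ℕ) : ℝ≥0∞) + (E.unit + b))
      (e := ((D * E.unit : ℕ) : ℝ≥0∞)) hE hn hl (hi.total_pos hH hk) hMw ?_ ?_ ?_ hw hρ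
    · calc E.val (t + 1) (.whilePos 12 roundBody :: K) ρ
          ≤ E.unit + E.val t (roundBody :: .whilePos 12 roundBody :: K) ρ :=
            Env.val_succ_cons_le hw (by simp) (by simp [step, hρ.r12])
        _ ≤ E.unit + (((roundTime P * E.unit : ℕ) : ℝ≥0∞) +
            ((((maxSteps P - i) * D * E.unit : ℕ) : ℝ≥0∞) + (E.unit + b) +
              ((D * E.unit : ℕ) : ℝ≥0∞) * 2⁻¹)) := by
            gcongr
        _ = _ := by
            have h2 : ((D * E.unit : ℕ) : ℝ≥0∞) * 2⁻¹ = ((roundTime P + 1) * E.unit : ℕ) := by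
              rw [hD, mul_assoc, Nat.cast_mul, mul_comm, ← mul_assoc, Nat.cast_ofNat,
                ENNReal.inv_mul_cancel (by simp) (by simp), one_mul]
            rw [h2, hsub, hD]
            push_cast
            ring
    · intro ρ' hw' hρ'
      refine (ih hK' i w hi ρ' hw' hρ').trans (le_of_eq ?_)
      rw [hsub]
      push_cast
      ring
    · rintro ρ' hw' ⟨x, hx, hxl, hρ'⟩
      refine (ih hK' (i + 1) _ (hi.step hH hk hx hxl) ρ' hw' hρ').trans (le_of_eq ?_)
      rw [show maxSteps P + 1 - (i + 1) = maxSteps P - i by omega]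
    · intro ρ' hw' hρ'
      refine (Env.val_while_zero hw' hρ'.1).trans ?_
      refine le_trans ?_ le_add_self
      gcongr
      exact hK' ρ' hw' hρ'

end Time

/-! ### Setup and total time -/

section Setup

variable {E : Env} {P : Params} {w : ℕ → ℕ} {H : Finset ℕ}

/-- The initialization of the weights, down to the index `r`. -/
def InitInv (P : Params) (r : ℕ) (ρ : ℕ → ℕ) : Prop :=
  (ρ 0 = P.n ∧ ρ 1 = P.m ∧ ρ 3 = 1 ∧ ρ 4 = 32 ∧ ρ 5 = 32 + P.m ∧ ρ 6 = 32 + 2 * P.m ∧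
    ρ 8 = P.s ∧ ρ 9 = 4 * P.s ∧ ρ 10 = P.m ∧ ρ 11 = 2 * P.k ∧ ρ 12 = 1) ∧ ρ 13 = r ∧ r ≤ P.m ∧
    (∀ j, r ≤ j → j < P.m → ρ (32 + j) = 1) ∧
    (∀ j, r ≤ j → j < P.m → ρ (32 + P.m + j) = P.s)

theorem hoare_initBody (hE : Roomy E P) (r : ℕ) :
    E.Hoare (InitInv P (r + 1)) (block [.sub 13 13 3, .add 14 4 13, .store 14 3, .add 14 5 13,
      .store 14 8]) 10 (InitInv P r) := by
  have hB := hE.hB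
  have hm := hE.hm
  refine Env.hoare_of_wp ?_ (by simp [block, Env.steps])
  rintro ρ _ ⟨⟨h0, h1, h3, h4, h5, h6, h8, h9, h10, h11, h12⟩, h13, hr, hw, hv⟩
  have hM1 : 32 + r ≤ E.M := by omega
  have hM2 : 32 + P.m + r ≤ E.M := by omega
  simp [block, Env.wp, hB, h0, h1, h3, h4, h5, h6, h8, h9, h10, h11, h12, h13, hM1, hM2, InitInv]
  refine ⟨by omega, by omega, by omega, by omega, by omega, by omega, fun j hj hj' => ?_,
    fun j hj hj' => ?_⟩
  · rw [Function.update_of_ne (by omega), Function.update_of_ne (by omega), Function.update_apply]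
    split_ifs with h
    · rfl
    · rw [Function.update_of_ne (by omega), Function.update_of_ne (by omega)]
      exact hw j (by omega) hj'
  · rw [Function.update_apply]
    split_ifs with h
    · rfl
    · repeat rw [Function.update_of_ne (by omega)]
      exact hv j (by omega) hj'

/-- The doubling loop that computes `l`, with `r` iterations left. -/
def LogInv (P : Params) (r : ℕ) (ρ : ℕ → ℕ) : Prop :=
  (ρ 0 = P.n ∧ ρ 1 = P.m ∧ ρ 2 = P.k ∧ ρ 3 = 1) ∧ ρ 13 = 4 * P.n ∧ ρ 14 = 2 ^ ρ 7 ∧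
    ρ 15 = 4 * P.n - ρ 14 ∧ ρ 7 + r = P.l

/-- A bound on the number of steps of the setup. -/
def setupTime (P : Params) : ℕ := 20 * P.l + 20 * P.m + 100

theorem hoare_setup (hE : Roomy E P) (hn : 0 < P.n) (hl : P.l = Nat.clog 2 (4 * P.n))
    (hkm : P.k < P.m) :
    E.Hoare (fun ρ => ρ 0 = P.n ∧ ρ 1 = P.m ∧ ρ 2 = P.k) setup (setupTime P)
      (Head P (fun _ => 1) (total P fun _ => 1)) := by
  have hB := hE.hB
  have hm := hE.hm
  have hnM := hE.hn
  have hsM := hE.hs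
  have hlM : P.l ≤ E.M := by
    have h1 : P.l ≤ P.s := by
      unfold Params.s
      exact Nat.le_mul_of_pos_left _ (by have := hE.hk; omega)
    omega
  refine Env.Hoare.conseq (Env.Hoare.seq (mid := LogInv P P.l) (Env.hoare_of_wp ?_ le_rfl)
    (Env.Hoare.seq (Env.hoare_while (T := 5) (LogInv P) ?_ ?_ (fun r => Env.hoare_of_wp ?_ ?_) P.l)
    (Env.Hoare.seq (mid := fun ρ => ρ 0 = P.n ∧ ρ 1 = P.m ∧ ρ 3 = 1 ∧ ρ 11 = 2 * P.k ∧ ρ 7 = P.l)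
      (Env.hoare_of_wp ?_ le_rfl)
    (Env.Hoare.seq (hoare_mul (u := 2 * P.k) (v := P.l) ?_ ?_ ?_ ?_ ?_ ?_ ?_ hlM)
    (Env.Hoare.seq (mid := InitInv P P.m) (Env.hoare_of_wp ?_ le_rfl)
      (Env.hoare_while (InitInv P) (fun ρ h => h.2.1) (fun r ρ h => by have := h.2.1; omega)
        (hoare_initBody hE) P.m))))))
    (fun _ _ h => h) (T' := setupTime P) ?_ ?_
  · rintro ρ _ ⟨h0, h1, h2⟩
    have hM1 : P.n + P.n ≤ E.M := by omega
    have hM2 : P.n + P.n + (P.n + P.n) ≤ E.M := by omega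
    have hM3 : 1 ≤ E.M := by omega
    simp [block, Env.wp, hB, h0, h1, h2, LogInv, hM2, hM3]
    omega
  · rintro ρ ⟨_, h13, h14, h15, h7⟩
    have h := Nat.le_pow_clog (b := 2) (by norm_num) (4 * P.n)
    rw [← hl, ← h7, add_zero, ← h14] at h
    omega
  · rintro r ρ ⟨_, h13, h14, h15, h7⟩
    have h := (Nat.lt_clog_iff_pow_lt (b := 2) (y := ρ 7) (x := 4 * P.n) (by norm_num)).mp
      (by omega)
    omega
  · rintro ρ _ ⟨⟨h0, h1, h2, h3⟩, h13, h14, h15, h7⟩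
    have h := (Nat.lt_clog_iff_pow_lt (b := 2) (y := ρ 7) (x := 4 * P.n) (by norm_num)).mp
      (by omega)
    have hM1 : ρ 14 + ρ 14 ≤ E.M := by omega
    have hM2 : ρ 7 + 1 ≤ E.M := by omega
    simp [block, Env.wp, hB, h0, h1, h2, h3, h13, LogInv, hM1, hM2]
    refine ⟨by omega, by omega, by omega, ?_, by omega⟩
    rw [h14, pow_succ]
    ring
  · simp [block, Env.steps]
  · rintro ρ _ ⟨⟨h0, h1, h2, h3⟩, _, _, _, h7⟩
    simp [Env.wp, hB, h0, h1, h2, h3]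
    omega
  · omega
  · omega
  · rintro ρ v ⟨h0, h1, h3, h11, h7⟩
    simp [h0, h1, h3, h11, h7]
  · rintro ρ v ⟨h0, h1, h3, h11, h7⟩
    simp [h0, h1, h3, h11, h7]
  · rintro ρ ⟨h0, h1, h3, h11, h7⟩
    exact ⟨h11, h7, h3⟩
  · omega
  · show P.s ≤ E.M
    omega
  · rintro ρ _ ⟨⟨h0, h1, h3, h11, h7⟩, h8⟩
    have hs : 2 * P.k * P.l = P.s := rfl
    rw [hs] at h8
    have hM1 : P.s + P.s ≤ E.M := by omega
    have hM2 : P.s + P.s + (P.s + P.s) ≤ E.M := by omega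
    have hM3 : 1 ≤ E.M := by omega
    have hM4 : P.m ≤ E.M := by omega
    have hM5 : 32 ≤ E.M := by omega
    have hM6 : 32 + P.m ≤ E.M := by omega
    have hM7 : 32 + P.m + P.m ≤ E.M := by omega
    simp [block, Env.wp, hB, h0, h1, h3, h8, h11, InitInv, hM1, hM2, hM3, hM4, hM5, hM6, hM7]
    exact ⟨by omega, by omega, by omega, by omega, by omega, by omega, by omega,
      ⟨by omega, by omega⟩, fun j hj hj' => by omega, fun j hj hj' => by omega⟩
  · simp [block, Env.steps, setupTime]
    omega
  · rintro ρ _ ⟨⟨h0, h1, h3, h4, h5, h6, h8, h9, h10, h11, h12⟩, h13, hr, hw, hv⟩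
    refine ⟨h0, h1, h3, h4, h5, h6, h9, by simp [h10, total], h11, h12, fun j hj => ?_,
      fun j hj => ?_⟩
    · simpa using hw j (Nat.zero_le _) hj
    · simpa using hv j (Nat.zero_le _) hj

/-- A bound on the expected time of the whole algorithm, in multiples of `E.unit` and apart from the
time for building the oracle. -/
noncomputable def totalTime (P : Params) : ℕ :=
  setupTime P + (maxSteps P + 1) * (2 * (roundTime P + 1)) + 12

theorem value_start_le (hE : Roomy E P) (hn : 0 < P.n) (hl : P.l = Nat.clog 2 (4 * P.n))
    (hM : 2 * P.s * P.m ^ 4 ≤ E.M) (hH : Covers E P H) (hkm : P.k < P.m)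
    (hG : ∀ ρ A, ρ 0 = 32 + 2 * P.m → ρ 1 = A.card → Sample P A ρ → SmallCover E P A → E.Good ρ)
    (t : ℕ) :
    value E.O E.Ok t (init setCoverProgram P.n P.m P.k) ≤
      ((E.O.buildTime + totalTime P * E.unit : ℕ) : ℝ≥0∞) := by
  have hB := hE.hB
  have hm := hE.hm
  have hnM := hE.hn
  have hl' : 4 * P.n ≤ 2 ^ P.l := hl ▸ Nat.le_pow_clog (by norm_num) _
  set ρ₀ : ℕ → ℕ := fun i => if i = 0 then P.n else if i = 1 then P.m else if i = 2 then P.k else 0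
    with hρ₀
  have hw₀ : E.Within ρ₀ := by
    constructor
    · intro i
      simp only [hρ₀]
      split_ifs <;> omega
    · intro i hi
      simp only [hρ₀]
      rw [if_neg (by omega), if_neg (by omega), if_neg (by omega)]
  set fin := block [.const 0 0, .add 0 0 6, .const 1 0, .add 1 1 16] with hfin
  have hfinal : ∀ t ρ, E.Within ρ → Found E P ρ → E.val t [fin] ρ ≤ ((7 * E.unit : ℕ) : ℝ≥0∞) := by
    intro t ρ hw hρ
    have h : E.Hoare (Found E P) fin 7 E.Good := by
      refine Env.hoare_of_wp ?_ (by simp [hfin, block, Env.steps])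
      rintro ρ _ ⟨_, h6, A, hS, hA⟩
      have hle := hS.le
      have h16 := hS.card
      have hM1 : 32 + 2 * P.m ≤ E.M := by omega
      have hM2 : A.card ≤ E.M := by omega
      simp [hfin, block, Env.wp, hB, h6, h16, hM1, hM2]
      refine ⟨by omega, hG _ A (by simp) (by simp) (by simp [hS]) hA⟩
    simpa using h t [] 0 ρ hw hρ fun ρ' hw' hg => (Env.val_nil hw' hg t).le
  set main : Program := .seq setup (.seq (.whilePos 12 roundBody) fin) with hmain
  have hval : ∀ t, E.val t [main] ρ₀ ≤
      (((1 + (setupTime P + (1 + ((maxSteps P + 1) * (2 * (roundTime P + 1)) + (1 + 7))))) *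
        E.unit : ℕ) : ℝ≥0∞) := by
    intro t
    refine (Env.val_cons_le (K' := [setup, .seq (.whilePos 12 roundBody) fin]) hw₀ (by simp [hmain])
      rfl).trans ?_
    have h1 := hoare_setup hE hn hl hkm t [.seq (.whilePos 12 roundBody) fin] (E.unit +
      (((((maxSteps P + 1) * (2 * (roundTime P + 1))) * E.unit : ℕ) : ℝ≥0∞) +
        (E.unit + (7 * E.unit : ℕ)))) ρ₀ hw₀ ⟨by simp [hρ₀], by simp [hρ₀], by simp [hρ₀]⟩
        fun ρ hw hρ => by
          refine (Env.val_cons_le hw (by simp) rfl).trans ?_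
          gcongr
          exact val_mainLoop_le hE hn hl' hM hH (by omega) (hfinal t) 0 _ progress_zero ρ hw hρ
    refine (add_le_add_right h1 _).trans (le_of_eq ?_)
    push_cast
    ring
  have hstart : init setCoverProgram P.n P.m P.k = ⟨[.seq .build main], ρ₀, false⟩ := rfl
  have hbuild : ∀ t, value E.O E.Ok t ⟨[.build, main], ρ₀, false⟩ ≤
      ((1 + E.O.buildTime : ℕ) : ℝ≥0∞) + E.val t [main] ρ₀ := by
    intro t
    cases t with
    | zero => simp [value]
    | succ t =>
      have hok : E.Ok ⟨[.build, main], ρ₀, false⟩ := ⟨hw₀, fun h => by simp at h⟩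
      rw [value, charge, if_pos hok]
      simp only [step, tsum_pure_mul]
      exact add_le_add le_rfl (E.val_mono t.le_succ _ _)
  have hunit : 1 ≤ E.unit := Nat.le_add_right _ _
  rw [hstart]
  cases t with
  | zero => simp [value]
  | succ t =>
    rw [value]
    simp only [step, tsum_pure_mul]
    calc _ ≤ (E.unit : ℝ≥0∞) + (((1 + E.O.buildTime : ℕ) : ℝ≥0∞) +
          (((1 + (setupTime P + (1 + ((maxSteps P + 1) * (2 * (roundTime P + 1)) + (1 + 7))))) *
        E.unit : ℕ) : ℝ≥0∞)) :=
          add_le_add (Env.charge_le hw₀ (by simp))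
            ((hbuild t).trans (add_le_add le_rfl (hval t)))
      _ ≤ _ := by
          norm_cast
          unfold totalTime
          nlinarith

end Setup

/-! ### The bounds in terms of the input sizes -/

theorem three_halves_le_logb {n : ℝ} (hn : 3 ≤ n) : 3 / 2 ≤ Real.logb 2 n := by
  rw [Real.le_logb_iff_rpow_le (by norm_num) (by linarith)]
  refine le_trans (abs_le_of_sq_le_sq' ?_ (by norm_num)).2 hn
  rw [← Real.rpow_natCast, ← Real.rpow_mul (by norm_num)]
  norm_num

theorem half_le_logb {x : ℝ} (hx : 3 / 2 ≤ x) : 1 / 2 ≤ Real.logb 2 x := by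
  rw [Real.le_logb_iff_rpow_le (by norm_num) (by linarith)]
  refine le_trans (abs_le_of_sq_le_sq' ?_ (by norm_num)).2 hx
  rw [← Real.rpow_natCast, ← Real.rpow_mul (by norm_num)]
  norm_num

/-- The bound on the number of reweightings is never less than a constant, even if `m = k + 1`, so
that it absorbs the final round. -/
theorem one_le_mul_logb_div {m k : ℕ} (hk : 1 ≤ k) (hkm : k < m) :
    1 ≤ (k : ℝ) * Real.logb 2 ((m : ℝ) / k) := by
  have hk' : (0 : ℝ) < k := by exact_mod_cast hk
  have h1 : (k : ℝ) + 1 ≤ m := by exact_mod_cast hkm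
  have hm' : (0 : ℝ) < m := by linarith
  rw [← Real.logb_pow, Real.le_logb_iff_rpow_le (by norm_num) (by positivity)]
  calc (2 : ℝ) ^ (1 : ℝ) = 1 + k * (1 / k : ℝ) := by
        rw [Real.rpow_one, mul_one_div_cancel hk'.ne']; norm_num
    _ ≤ (1 + 1 / k : ℝ) ^ k := one_add_mul_le_pow (by
        have : (0 : ℝ) < 1 / k := by positivity
        linarith) k
    _ ≤ _ := by
        gcongr
        rw [le_div_iff₀ hk', add_mul, one_div_mul_cancel hk'.ne']
        linarith

theorem clog_le_three_mul_logb {n : ℕ} (hn : 3 ≤ n) :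
    (Nat.clog 2 (4 * n) : ℝ) ≤ 3 * Real.logb 2 n := by
  have hn' : (3 : ℝ) ≤ n := by exact_mod_cast hn
  set l := Nat.clog 2 (4 * n) with hl
  have h1 : 2 ^ (l - 1) < 4 * n := Nat.pow_pred_clog_lt_self (by norm_num) (by omega)
  have h2 : (2 : ℝ) ^ l ≤ 8 * n := by
    have h3 : 2 ^ l ≤ 8 * n := by
      calc 2 ^ l ≤ 2 ^ (l - 1 + 1) := Nat.pow_le_pow_right (by norm_num) (by omega)
        _ = 2 * 2 ^ (l - 1) := pow_succ' _ _
        _ ≤ 8 * n := by omega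
    exact_mod_cast h3
  have h4 := Real.logb_le_logb_of_le (b := 2) (by norm_num) (by positivity) h2
  rw [Real.logb_pow, Real.logb_self_eq_one (by norm_num), Real.logb_mul (by norm_num)
    (by positivity), show (8 : ℝ) = 2 ^ 3 by norm_num, Real.logb_pow,
    Real.logb_self_eq_one (by norm_num)] at h4
  have := three_halves_le_logb hn'
  push_cast at h4
  linarith

/-- The parameters of an instance with `n` elements, `m` sets and a cover of size `k`. -/
def params (n m k : ℕ) : Params := ⟨n, m, k, Nat.clog 2 (4 * n)⟩

theorem totalTime_le {n m k : ℕ} (hn : 3 ≤ n) (hk : 1 ≤ k) (hkm : k < m) :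
    (totalTime (params n m k) : ℝ) ≤ 6140 * (k * Real.logb 2 ((m : ℝ) / k) *
      (n * k * Real.logb 2 (n * k) * Real.logb 2 (Real.logb 2 n) + m)) := by
  have hn' : (3 : ℝ) ≤ n := by exact_mod_cast hn
  have hk' : (1 : ℝ) ≤ k := by exact_mod_cast hk
  have hkm' : (k : ℝ) + 1 ≤ m := by exact_mod_cast hkm
  have hx := three_halves_le_logb hn'
  have hxx := half_le_logb hx
  have hl := clog_le_three_mul_logb hn
  have hY := one_le_mul_logb_div hk hkm
  have hlog : Real.logb 2 n ≤ Real.logb 2 (n * k) :=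
    Real.logb_le_logb_of_le (by norm_num) (by positivity) (by nlinarith)
  have hsteps : (maxSteps (params n m k) : ℝ) ≤ 4 * (k * Real.logb 2 ((m : ℝ) / k)) := by
    refine (Nat.floor_le ?_).trans (le_of_eq (mul_assoc _ _ _))
    rw [mul_assoc]
    show 0 ≤ 4 * ((k : ℝ) * Real.logb 2 ((m : ℝ) / k))
    linarith
  set Y := (k : ℝ) * Real.logb 2 ((m : ℝ) / k)
  set x := Real.logb 2 (n : ℝ)
  set l := Nat.clog 2 (4 * n)
  set A := (n : ℝ) * k * Real.logb 2 (n * k) * Real.logb 2 x with hA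
  have hnk : (3 : ℝ) ≤ n * k := by nlinarith
  have hA1 : (n : ℝ) * k * x ≤ 2 * A := by
    have h1 : (n : ℝ) * k * x ≤ n * k * Real.logb 2 (n * k) := by gcongr
    have h2 : 0 ≤ (n : ℝ) * k * Real.logb 2 (n * k) := by nlinarith
    rw [hA]
    nlinarith
  have hn1 : (n : ℝ) ≤ n * k * x := by nlinarith
  have hx1 : x ≤ n * k * x := by nlinarith
  have hround : (roundTime (params n m k) : ℝ) + 1 ≤ 600 * (A + m) := by
    have h1 : (roundTime (params n m k) : ℝ) =
        88 * (n * k * l) + 31 * n + 80 * m + 10 * k + 100 := by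
      simp only [roundTime, params, Params.s]
      push_cast
      ring
    have h2 : (n : ℝ) * k * l ≤ n * k * (3 * x) := by gcongr
    linarith
  have hsetup : (setupTime (params n m k) : ℝ) + 12 ≤ 140 * (A + m) := by
    have h1 : (setupTime (params n m k) : ℝ) = 20 * l + 20 * m + 100 := by
      simp only [setupTime, params]
      push_cast
      ring
    linarith
  have hAm : 0 ≤ A + m := by linarith
  calc (totalTime (params n m k) : ℝ)
      = (setupTime (params n m k) + 12) + (maxSteps (params n m k) + 1) *
          (2 * (roundTime (params n m k) + 1)) := by
        unfold totalTime
        push_cast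
        ring
    _ ≤ 140 * (A + m) + (5 * Y) * (2 * (600 * (A + m))) := by
        gcongr
        linarith
    _ ≤ 6140 * (Y * (A + m)) := by nlinarith

theorem params_l_le (n m k : ℕ) : (params n m k).l ≤ 4 * n :=
  Nat.clog_le_of_le_pow Nat.lt_two_pow_self.le

/-- All numbers of the algorithm are at most `(n + m) ^ 8`. -/
theorem params_bounds {n m k : ℕ} (hn : 3 ≤ n) (hk : 1 ≤ k) (hkm : k < m) :
    8 * n ≤ (n + m) ^ 8 ∧ 32 + 3 * m ≤ (n + m) ^ 8 ∧ 4 * (params n m k).s ≤ (n + m) ^ 8 ∧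
      2 * (params n m k).s * m ^ 4 ≤ (n + m) ^ 8 := by
  have hz : 5 ≤ n + m := by omega
  have hs : (params n m k).s ≤ 8 * (n + m) ^ 2 := by
    calc (params n m k).s ≤ 2 * (n + m) * (4 * (n + m)) :=
          Nat.mul_le_mul (Nat.mul_le_mul_left _ (by show k ≤ _; omega))
            ((params_l_le n m k).trans (by omega))
      _ = _ := by ring
  have hm4 : m ^ 4 ≤ (n + m) ^ 4 := Nat.pow_le_pow_left (by omega) _
  set z := n + m
  have h2 : 25 ≤ z ^ 2 := by nlinarith
  have h6 : 625 * z ^ 2 ≤ z ^ 6 := by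
    calc 625 * z ^ 2 ≤ (z ^ 2 * z ^ 2) * z ^ 2 := by gcongr; nlinarith
      _ = z ^ 6 := by ring
  have h8 : 25 * z ^ 6 ≤ z ^ 8 := by
    calc 25 * z ^ 6 ≤ z ^ 2 * z ^ 6 := by gcongr
      _ = z ^ 8 := by ring
  have hz2 : z ≤ z ^ 2 := by nlinarith
  refine ⟨by omega, by omega, by omega, ?_⟩
  calc 2 * (params n m k).s * m ^ 4 ≤ 2 * (8 * z ^ 2) * z ^ 4 := by gcongr
    _ = 16 * z ^ 6 := by ring
    _ ≤ _ := by omega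

/-- The property of the final memory: the output is a small set of indices of sets that cover
everything. -/
def GoodOutput (O : Oracle) (P : Params) (ρ : ℕ → ℕ) : Prop :=
  ∃ A ⊆ Finset.range P.m, (Finset.range (ρ 1)).image (fun i => ρ (ρ 0 + i)) = A ∧
    A.card ≤ 4 * P.s ∧ ∀ x < P.n, ∃ j ∈ A, O.answer x j

/-- The environment of an instance: `32` registers and three tables of length `m` are available, for
numbers up to `(n + m) ^ 8`. -/
def env (O : Oracle) (n m k : ℕ) : Env where
  O := O
  B := 32 + 3 * m
  M := (n + m) ^ 8
  Good := GoodOutput O (params n m k)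

theorem roomy_env (O : Oracle) {n m k : ℕ} (hn : 3 ≤ n) (hk : 1 ≤ k) (hkm : k < m) :
    Roomy (env O n m k) (params n m k) := by
  obtain ⟨h1, h2, h3, _⟩ := params_bounds hn hk hkm
  exact ⟨rfl, h1, h2, h3, hk, Nat.clog_pos (by norm_num) (by omega)⟩

theorem value_env_le (O : Oracle) {n m k : ℕ} (hn : 3 ≤ n) (hk : 1 ≤ k) (hkm : k < m)
    {H : Finset ℕ} (hsub : H ⊆ Finset.range m) (hcard : H.card = k)
    (hcov : ∀ x < n, ∃ j ∈ H, O.answer x j) (t : ℕ) :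
    value O (env O n m k).Ok t (init setCoverProgram n m k) ≤
      ((O.buildTime + totalTime (params n m k) * (1 + O.queryTime) : ℕ) : ℝ≥0∞) := by
  refine value_start_le (E := env O n m k) (P := params n m k) (roomy_env O hn hk hkm)
    (by show 0 < n; omega) rfl (params_bounds hn hk hkm).2.2.2 ⟨hsub, hcard, hcov⟩ hkm ?_ t
  rintro ρ A h0 h1 hS ⟨hA, hcov⟩
  refine ⟨A, hS.sub, ?_, hA, hcov⟩
  rw [h0, h1]
  conv_rhs => rw [hS.image, hS.card]

/-- A set cover as a set of indices. -/
theorem exists_indexCover {X : Type*} [Fintype X] {R : Finset (Finset X)} {n m : ℕ}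
    (eX : Fin n ≃ X) (eR : Fin m ≃ R) (TP TQ SO : ℕ) {S : Finset (Finset X)}
    (hS : IsSetCover R S) :
    ∃ H ⊆ Finset.range m, H.card = S.card ∧
      ∀ x < n, ∃ j ∈ H, (membershipOracle eX eR TP TQ SO).answer x j := by
  classical
  set f : Fin m → Finset X := fun j => (eR j : Finset X) with hf
  have hinj : Function.Injective f := Subtype.val_injective.comp eR.injective
  set F := Finset.univ.filter fun j => f j ∈ S with hF
  have himage : F.image f = S := by
    ext r
    simp only [hF, Finset.mem_image, Finset.mem_filter, Finset.mem_univ, true_and]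
    constructor
    · rintro ⟨j, hj, rfl⟩
      exact hj
    · intro hr
      exact ⟨eR.symm ⟨r, hS.1 hr⟩, by simpa [hf] using hr, by simp [hf]⟩
  refine ⟨F.map Fin.valEmbedding, ?_, ?_, ?_⟩
  · intro a ha
    obtain ⟨j, _, rfl⟩ := Finset.mem_map.mp ha
    exact Finset.mem_range.mpr j.2
  · rw [Finset.card_map, ← himage, Finset.card_image_of_injective _ hinj]
  · intro x hx
    obtain ⟨r, hr, hxr⟩ := hS.2 (eX ⟨x, hx⟩)
    rw [← himage, Finset.mem_image] at hr
    obtain ⟨j, hj, rfl⟩ := hr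
    refine ⟨j, Finset.mem_map.mpr ⟨j, hj, rfl⟩, ?_⟩
    simp [membershipOracle, hx, hf ▸ hxr]

theorem size_le {n m k : ℕ} (hn : 3 ≤ n) (hk : 1 ≤ k) :
    ((4 * (params n m k).s : ℕ) : ℝ) ≤
      48 * (Real.logb 2 n * k * Real.logb 2 (Real.logb 2 n * k)) := by
  have hn' : (3 : ℝ) ≤ n := by exact_mod_cast hn
  have hk' : (1 : ℝ) ≤ k := by exact_mod_cast hk
  have hx := three_halves_le_logb hn'
  have hl := clog_le_three_mul_logb hn
  have hs : ((4 * (params n m k).s : ℕ) : ℝ) = 8 * k * Nat.clog 2 (4 * n) := by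
    simp only [params, Params.s]
    push_cast
    ring
  set x := Real.logb 2 (n : ℝ)
  have hxk : 3 / 2 ≤ x * k := by nlinarith
  have hlog := half_le_logb hxk
  calc _ = (8 * k * Nat.clog 2 (4 * n) : ℝ) := hs
    _ ≤ 8 * k * (3 * x) := by gcongr
    _ = 24 * (x * k) := by ring
    _ ≤ _ := by nlinarith

theorem isSetCover_image {X : Type*} [DecidableEq X] {R : Finset (Finset X)} {n m : ℕ}
    (eX : Fin n ≃ X) (eR : Fin m ≃ R) (TP TQ SO : ℕ) {J : Finset (Fin m)}
    (hJ : ∀ x < n, ∃ j ∈ J.image (fun j : Fin m => (j : ℕ)),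
      (membershipOracle eX eR TP TQ SO).answer x j) :
    IsSetCover R (J.image fun j => (eR j : Finset X)) := by
  constructor
  · intro r hr
    obtain ⟨j, _, rfl⟩ := Finset.mem_image.mp hr
    exact (eR j).2
  · intro x
    obtain ⟨j', hj', hx⟩ := hJ (eX.symm x) (eX.symm x).2
    obtain ⟨j, hj, rfl⟩ := Finset.mem_image.mp hj'
    refine ⟨eR j, Finset.mem_image_of_mem _ hj, ?_⟩
    simpa [membershipOracle] using hx

end RAM

theorem mainTheorem6 :
    ∃ (P : RAM.Program) (C : ℕ),
      ∀ (X : Type*) [Fintype X] [DecidableEq X] (R : Finset (Finset X)) (k : ℕ)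
        (eX : Fin (Fintype.card X) ≃ X) (eR : Fin R.card ≃ R) (TP TQ SO : ℕ),
        3 ≤ Fintype.card X → 1 ≤ TQ → k < R.card →
        (∃ S, IsSetCover R S ∧ S.card = k) →
        let O := RAM.membershipOracle eX eR TP TQ SO
        let start := RAM.init P (Fintype.card X) R.card k
        let n : ℝ := Fintype.card X
        let m : ℝ := R.card
        let δ : ℝ := Real.logb 2 n
        -- the algorithm halts almost surely, and its output is always a small set cover
        RAM.haltProb O start = 1 ∧
        (∀ c, RAM.Reachable O start c → c.Halted →
          ∃ J : Finset (Fin R.card), c.output = J.image (fun j : Fin R.card => (j : ℕ)) ∧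
            IsSetCover R (J.image (fun j : Fin R.card => (eR j : Finset X))) ∧
            ((J.image (fun j : Fin R.card => (eR j : Finset X))).card : ℝ)
              ≤ C * (δ * k * Real.logb 2 (δ * k))) ∧
        -- expected running time
        RAM.expectedTime O start ≤ ENNReal.ofReal
          (C * (k * Real.logb 2 (m / k) * TQ *
            (n * k * Real.logb 2 (n * k) * Real.logb 2 (Real.logb 2 n) + m) + TP)) ∧
        -- space, in memory cells of logarithmically many bits
        (∀ c, RAM.Reachable O start c →
          RAM.FitsIn O c (C * (R.card + SO)) ∧
          ∀ i, c.reg i ≤ (Fintype.card X + R.card) ^ C) := by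
  -- `12280 = 2 * 6140`, where `6140` is the constant of `RAM.totalTime_le` and the factor `2` comes
  -- from `1 + TQ ≤ 2 * TQ`. The numeral is hidden so that powers with this exponent stay symbolic.
  obtain ⟨C, hC⟩ : ∃ C : ℕ, C = 12280 := ⟨_, rfl⟩
  refine ⟨RAM.setCoverProgram, C, ?_⟩
  intro X _ _ R k eX eR TP TQ SO hn hTQ hkm ⟨S, hS, hSk⟩ O start n m δ
  have hk : 1 ≤ k := by
    obtain ⟨r, hr, _⟩ := hS.2 (eX ⟨0, by omega⟩)
    rw [← hSk]
    exact Finset.card_pos.mpr ⟨r, hr⟩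
  have hk' : (1 : ℝ) ≤ k := by exact_mod_cast hk
  obtain ⟨H, hsub, hcard, hcov⟩ := RAM.exists_indexCover eX eR TP TQ SO hS
  have hval := RAM.value_env_le O hn hk hkm hsub (hcard.trans hSk) hcov
  have hok : ∀ c, RAM.Reachable O start c → (RAM.env O (Fintype.card X) R.card k).Ok c :=
    fun c hc => RAM.ok_of_reachable hval (ENNReal.natCast_ne_top _) hc
  refine ⟨RAM.haltProb_eq_one_of_value_le hval (ENNReal.natCast_ne_top _), ?_, ?_, ?_⟩
  · intro c hc hhalt
    obtain ⟨A, hA, hout, hAcard, hAcov⟩ := (hok c hc).2 hhalt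
    set J := Finset.univ.filter fun j : Fin R.card => (j : ℕ) ∈ A
    have hJ : J.image (fun j : Fin R.card => (j : ℕ)) = A := by
      ext a
      simp only [J, Finset.mem_image, Finset.mem_filter, Finset.mem_univ, true_and]
      constructor
      · rintro ⟨j, hj, rfl⟩
        exact hj
      · exact fun ha => ⟨⟨a, Finset.mem_range.mp (hA ha)⟩, ha, rfl⟩
    refine ⟨J, hout.trans hJ.symm, RAM.isSetCover_image eX eR TP TQ SO (by rwa [hJ]), ?_⟩
    have hJcard : J.card = A.card := by
      rw [← hJ, Finset.card_image_of_injective _ Fin.val_injective]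
    have hcard : (J.image (fun j : Fin R.card => (eR j : Finset X))).card ≤
        4 * (RAM.params (Fintype.card X) R.card k).s :=
      Finset.card_image_le.trans (hJcard ▸ hAcard)
    calc _ ≤ ((4 * (RAM.params (Fintype.card X) R.card k).s : ℕ) : ℝ) := by exact_mod_cast hcard
      _ ≤ 48 * (δ * k * Real.logb 2 (δ * k)) := RAM.size_le hn hk
      _ ≤ _ := by
          have hδ : 3 / 2 ≤ δ := RAM.three_halves_le_logb (by simpa [n] using hn)
          have hδk : 3 / 2 ≤ δ * k := by nlinarith
          have := RAM.half_le_logb hδk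
          have h0 : 0 ≤ δ * k * Real.logb 2 (δ * k) := by nlinarith
          rw [hC]
          push_cast
          linarith
  · refine (RAM.expectedTime_le_of_value_le hval).trans ?_
    rw [← ENNReal.ofReal_natCast]
    apply ENNReal.ofReal_le_ofReal
    have htotal := RAM.totalTime_le hn hk hkm
    have hTQ' : (1 : ℝ) ≤ TQ := by exact_mod_cast hTQ
    have hTP : (0 : ℝ) ≤ TP := Nat.cast_nonneg _
    set T := (RAM.totalTime (RAM.params (Fintype.card X) R.card k) : ℝ) with hT
    have hT0 : 0 ≤ T := Nat.cast_nonneg _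
    have hcast : ((O.buildTime + RAM.totalTime (RAM.params (Fintype.card X) R.card k) *
        (1 + O.queryTime) : ℕ) : ℝ) = TP + T * (1 + TQ) := by
      push_cast
      rfl
    rw [hcast, hC]
    push_cast
    calc TP + T * (1 + TQ) ≤ TP + T * (2 * TQ) := by
          gcongr
          linarith
      _ ≤ TP + 6140 * (k * Real.logb 2 (m / k) *
            (n * k * Real.logb 2 (n * k) * Real.logb 2 (Real.logb 2 n) + m)) * (2 * TQ) := by
          gcongr
      _ ≤ 12280 * TP + 6140 * (k * Real.logb 2 (m / k) *
            (n * k * Real.logb 2 (n * k) * Real.logb 2 (Real.logb 2 n) + m)) * (2 * TQ) := by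
          gcongr
          linarith
      _ = _ := by ring
  · intro c hc
    have hw := (hok c hc).1
    refine ⟨⟨32 + 3 * R.card, hw.2, ?_⟩, fun i => (hw.1 i).trans ?_⟩
    · have h1 : (if c.built then O.space else 0) ≤ SO := by
        split_ifs
        · exact le_rfl
        · exact Nat.zero_le _
      have h2 : 12280 * (R.card + SO) = 12280 * R.card + 12280 * SO := by ring
      rw [hC, h2]
      omega
    · exact Nat.pow_le_pow_right (by omega) (by omega)
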